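/- **Conventions.** Groups are structures in the language $(\cdot,{}^{-1},1)$ and fields are structures in the language $(+,\cdot,-,0,1)$. An interpretation code $\Gamma$ of $L$-structures in $K$-structures consists of parameter-free $K$-formulas, in finitely many parameter variables $\bar y$, which define a domain $U_\Gamma$ of $d$-tuples, an equality relation on $U_\Gamma$, the graphs of the function symbols of $L$ and the relation symbols of $L$. For a tuple $\bar p$ of parameters in a $K$-structure $B$, one writes $A\simeq\Gamma(B,\bar p)$ if these formulas, with $\bar y=\bar p$, define on the quotient of $U_\Gamma$ by the equality relation an $L$-structure $\Gamma(B,\bar p)$ isomorphic to $A$. One writes $A\simeq\Gamma(B,\varphi)$, for a parameter-free formula $\varphi(\bar y)$, if $\varphi$ is satisfied by some tuple of $B$ and $A\simeq\Gamma(B,\bar p)$ for every tuple $\bar p$ of $B$ satisfying $\varphi$. The structures $A$ and $B$ are *regularly bi-interpretable* if there are codes $\Gamma,\Delta$ and parameter-free formulas $\varphi,\psi,\theta_A,\theta_B$ such that 1. $A\simeq\Gamma(B,\varphi)$ and $B\simeq\Delta(A,\psi)$; 2. for every $\bar q$ in $A$ satisfying $\psi$ and every tuple $\bar s$ of representatives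 of elements of $\Delta(A,\bar q)$ which satisfies $\varphi$ in $\Delta(A,\bar q)$, the formula $\theta_A$ with the parameters $\bar q,\bar s$ defines in $A$ an isomorphism of $\Gamma(\Delta(A,\bar q),\bar s)$ onto $A$; and symmetrically $\theta_B$ defines in $B$ isomorphisms of $\Delta(\Gamma(B,\bar p),\bar s)$ onto $B$, uniformly in all admissible parameters. **Theorem A1.** Let $F$ be a field and let $n\ge 3$. Then the group $G=SL_n(F)$ is regularly bi-interpretable with $F$. Moreover, there is a regular bi-interpretation $F\simeq\Gamma(G,\varphi)$, $G\simeq\Delta(F)$ such that: * the parameter tuples of $\Gamma$ are indexed by the pairs $(i,j)$ with $1\le i\ne j\le n$, the tuple $\mathcal T_n=(t_{ij})_{i\ne j}$ of the transvections $t_{ij}=I_n+e_{ij}$ satisfies $\varphi$, and $\Gamma(G,\mathcal T_n)$ is the field with underlying set the root subgroup $T_{1n}=\{t_{1n}(\alpha)\mid\alpha\in F\}$, where $t_{1n}(\alpha)=I_n+\alpha e_{1n}$, and with the operations for which $\alpha\mapsto t_{1n}(\alpha)$ is an isomorphism of $F$ onto $\Gamma(G,\mathcal T_n)$; * $\Delta$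 has no parameters and is the standard interpretation: its domain in $F$ is the set of the $n^2$-tuples which are the entries of a matrix of determinant $1$, with matrix multiplication as the operation. -/

import Mathlib

open FirstOrder

/-- The function symbols of the language of groups. -/
inductive GroupFunc : ℕ → Type
  | mul : GroupFunc 2
  | inv : GroupFunc 1
  | one : GroupFunc 0

/-- The first-order language of groups, with symbols for the product, the inverse and the
identity element. -/
def groupLanguage : Language :=
  { Functions := GroupFunc
    Relations := fun _ => Empty }

/-- A group as a structure for the language of groups. -/
instance groupStructure (G : Type*) [Group G] : groupLanguage.Structure G where
  funMap := fun {k} f =>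
    match k, f with
    | _, .mul => fun x => x 0 * x 1
    | _, .inv => fun x => (x 0)⁻¹
    | _, .one => fun _ => 1
  RelMap := fun {_} r => r.elim

/- A field is viewed as a structure for Mathlib's language of rings, with its own operations. -/
attribute [local instance] FirstOrder.Ring.compatibleRingOfRing

/-- An interpretation code: the formulas, without parameters, which describe an `L`-structure
inside `K`-structures. The variables indexed by `P` are placeholders for parameters, and the
elements of the interpreted structure are represented by `ι`-tuples. -/
structure InterpretationCode (L K : Language) (P ι : Type) where
  /-- the formula `U(p, x)` which defines the domain -/
  dom : K.Formula (P ⊕ ι)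
  /-- the formula `E(p, x, y)`: the tuples `x` and `y` represent the same element -/
  eq : K.Formula (P ⊕ (ι ⊕ ι))
  /-- the formula which defines the graph `f(x₁, …, xₖ) = y` of a function symbol -/
  fn : ∀ {k : ℕ}, L.Functions k → K.Formula (P ⊕ ((Fin k × ι) ⊕ ι))
  /-- the formula which defines a relation symbol -/
  rel : ∀ {k : ℕ}, L.Relations k → K.Formula (P ⊕ (Fin k × ι))

namespace InterpretationCode

variable {L K : Language} {P ι : Type} (Γ : InterpretationCode L K P ι)
variable {B : Type*} [K.Structure B] (p : P → B)

/-- The set `U_Γ(B, p)` of the tuples over `B` which represent elements. -/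
abbrev Domain : Type _ := {x : ι → B // Γ.dom.Realize (Sum.elim p x)}

/-- `μ : U_Γ(B, p) → A` is a coordinate map of an interpretation of `A` in `B` by the code `Γ`
with the parameters `p`: it is onto, its kernel is defined by `Γ.eq`, and the preimages of the
(graphs of the) basic operations and relations of `A` are defined by `Γ.fn` and `Γ.rel`.
Equivalently, the formulas of `Γ` define an `L`-structure `Γ(B, p)` on the quotient of
`U_Γ(B, p)` by `Γ.eq`, and `μ` induces an isomorphism of `Γ(B, p)` onto `A`. -/
structure IsCoordinateMap {A : Type*} [L.Structure A] (μ : Γ.Domain p → A) : Prop where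
  surjective : Function.Surjective μ
  eq_iff : ∀ x y : Γ.Domain p,
    Γ.eq.Realize (Sum.elim p (Sum.elim x.1 y.1)) ↔ μ x = μ y
  fn_iff : ∀ {k : ℕ} (f : L.Functions k) (x : Fin k → Γ.Domain p) (y : Γ.Domain p),
    (Γ.fn f).Realize (Sum.elim p (Sum.elim (fun ji => (x ji.1).1 ji.2) y.1)) ↔
      Language.Structure.funMap f (fun j => μ (x j)) = μ y
  rel_iff : ∀ {k : ℕ} (r : L.Relations k) (x : Fin k → Γ.Domain p),
    (Γ.rel r).Realize (Sum.elim p (fun ji => (x ji.1).1 ji.2)) ↔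
      Language.Structure.RelMap r (fun j => μ (x j))

/-- `Γ(B, p) ≃ A`. -/
def Interprets (A : Type*) [L.Structure A] : Prop :=
  ∃ μ : Γ.Domain p → A, Γ.IsCoordinateMap p μ

end InterpretationCode

/-- `A ≃ Γ(B, φ)`: the code `Γ` regularly interprets `A` in `B` with respect to the formula `φ`,
i.e. `φ` is satisfied by some tuple of `B`, and `A ≃ Γ(B, p)` for every tuple `p` of `B` which
satisfies `φ`. -/
def RegularlyInterprets {L K : Language} {P ι : Type} (Γ : InterpretationCode L K P ι)
    (φ : K.Formula P) (A B : Type*) [L.Structure A] [K.Structure B] : Prop :=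
  (∃ p : P → B, φ.Realize p) ∧ ∀ p : P → B, φ.Realize p → Γ.Interprets p A

/-- Let `A ≃ Γ(B, φ)` and `B ≃ Δ(A, ψ)`. For `q` in `A` with `ψ(q)` and for a tuple `s` of elements
of `Δ(A, q)` which satisfies `φ` in `Δ(A, q)`, the composed code `Γ ∘ Δ` with the parameters
`(q, s)` gives the copy `Γ(Δ(A, q), s)` of `A`. The formula `θ` defines, uniformly in the
parameters `(q, s)`, an isomorphism of this copy onto `A`.

Here `Δ(A, q)` is identified with `B` by a coordinate map `ν`; the tuples `s` and `u` run over
representatives, in `U_Δ(A, q)`, of the parameters and of the elements of `U_Γ(Δ(A, q), s)`, and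
`θ(q, s, u, a)` says that the element represented by `u` is mapped to `a`. -/
def DefinesReturnIsomorphism {L K : Language} {P ι Q κ : Type}
    (Γ : InterpretationCode L K P ι) (φ : K.Formula P)
    (Δ : InterpretationCode K L Q κ) (ψ : L.Formula Q)
    (θ : L.Formula (Q ⊕ ((P × κ) ⊕ ((ι × κ) ⊕ Unit))))
    (A B : Type*) [L.Structure A] [K.Structure B] : Prop :=
  ∀ q : Q → A, ψ.Realize q →
  ∀ ν : Δ.Domain q → B, Δ.IsCoordinateMap q ν →
  ∀ s : P → Δ.Domain q, φ.Realize (fun i => ν (s i)) →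
  ∃ μ : Γ.Domain (fun i => ν (s i)) → A, Γ.IsCoordinateMap (fun i => ν (s i)) μ ∧
    ∀ (u : ι → Δ.Domain q) (a : A),
      θ.Realize (Sum.elim q (Sum.elim (fun ik => (s ik.1).1 ik.2)
          (Sum.elim (fun jk => (u jk.1).1 jk.2) (fun _ => a)))) ↔
        ∃ h : Γ.dom.Realize (Sum.elim (fun i => ν (s i)) (fun j => ν (u j))),
          μ ⟨fun j => ν (u j), h⟩ = a

/-- A regular bi-interpretation of the `L`-structure `A` and the `K`-structure `B`: regular
interpretations `A ≃ Γ(B, φ)` and `B ≃ Δ(A, ψ)`, together with formulas `θA` and `θB` which define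
in `A` and in `B`, uniformly in all admissible parameters, isomorphisms of `Γ(Δ(A))` onto `A` and
of `Δ(Γ(B))` onto `B`. No formula contains parameters other than those shown. The index types `P`,
`Q` of the parameter tuples and `ι`, `κ` of the representing tuples are finite. -/
structure RegularBiInterpretation (L K : Language) (A B : Type*) [L.Structure A] [K.Structure B]
    (P ι Q κ : Type) [Finite P] [Finite ι] [Finite Q] [Finite κ] where
  Γ : InterpretationCode L K P ι
  φ : K.Formula P
  Δ : InterpretationCode K L Q κ
  ψ : L.Formula Q
  θA : L.Formula (Q ⊕ ((P × κ) ⊕ ((ι × κ) ⊕ Unit)))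
  θB : K.Formula (P ⊕ ((Q × ι) ⊕ ((κ × ι) ⊕ Unit)))
  regular_left : RegularlyInterprets Γ φ A B
  regular_right : RegularlyInterprets Δ ψ B A
  iso_left : DefinesReturnIsomorphism Γ φ Δ ψ θA A B
  iso_right : DefinesReturnIsomorphism Δ ψ Γ φ θB B A

/-- `A` and `B` are regularly bi-interpretable. -/
def RegularlyBiInterpretable (L K : Language) (A B : Type*) [L.Structure A] [K.Structure B] :
    Prop :=
  ∃ (P ι Q κ : Type) (_ : Finite P) (_ : Finite ι) (_ : Finite Q) (_ : Finite κ),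
    Nonempty (RegularBiInterpretation L K A B P ι Q κ)

/-- The tuple of all transvections `t_{ij} = t_{ij}(1)`, `i ≠ j`, in `SL_n(F)`. -/
def transvectionTuple (n : ℕ) (F : Type*) [Field F] :
    {ij : Fin n × Fin n // ij.1 ≠ ij.2} → Matrix.SpecialLinearGroup (Fin n) F :=
  fun ij => Matrix.SpecialLinearGroup.transvection ij.2 1

/-- The element `t_{1n}(α)` of the root subgroup `T_{1n}` of `SL_n(F)`. -/
def rootElement {n : ℕ} (hn : 3 ≤ n) {F : Type*} [Field F] (α : F) :
    Matrix.SpecialLinearGroup (Fin n) F :=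
  Matrix.SpecialLinearGroup.transvection
    (i := (⟨0, by omega⟩ : Fin n)) (j := (⟨n - 1, by omega⟩ : Fin n))
    (by simp only [ne_eq, Fin.mk.injEq]; omega) α

/-!
Write `G = SL_n(F)`, let `p = (p_{ij})` be a tuple of elements of `G` indexed by the pairs `i ≠ j`,
and put `N_{ij} = p_{ij} - 1`. The letter `σ` stands for automorphisms of `G`.

Since definable sets are invariant under automorphisms, and since two coordinate maps with the same
parameters differ by an automorphism of the interpreted structure, everything has to be checked for
one choice of the parameters and of the coordinate maps only, provided that the formula `φ` defines
a set of tuples which are images of the tuple of the elementary transvections under automorphisms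
(`RegularBiInterpretation.ofOrbit`). The formulas are never written down; they come from closure
properties of the relation `IsDefinable`.

The formula `φ` states the Steinberg relations, that the `p_{ij}` are nontrivial, and a condition
which makes them unipotent: `p_{ij}^q = 1` in characteristic `q > 0`, and in characteristic zero
the conjugacy of `p_{ij}` to two of its powers, which forces the eigenvalues to be `1`
(`Matrix.isNilpotent_sub_one_of_conj`). The argument for the orbit
(`IsTransvectionTuple.exists_mulEquiv`) has three steps.
* Kolchin: the group generated by the `p_{ij}` with `i < j` is unipotent, so that the space has a
  chain of invariant subspaces on whose quotients it acts trivially. Now `p_{1n}` is an iterated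
  commutator of length `n - 1`, and this leaves only rank one for `N_{1n}`
  (`IsSteinberg.exists_vecMulVec_of_extreme`). The relations are symmetric in the indices; hence all
  the `N_{ij}` have rank one.
* For elements of rank one, the Steinberg relations say that the `N_{ij}` multiply either as the
  matrix units `e_{ij}`, or as the matrices `-e_{ji}` (`isMatrixUnits_or`).
* Matrix units in `M_n(F)` are conjugate to the standard ones (`IsMatrixUnits.exists_conj`), and the
  inverse transpose exchanges the two cases (`IsSteinberg.exists_mulEquiv`).
The automorphisms obtained satisfy `σ (t_{1n}(α)) = 1 + α (p_{1n} - 1)`, and this equation defines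
the isomorphism of `Γ(Δ(F))` onto `F`.

In `G`, the root subgroup `T_{1n}` consists of the commutators of `t_{2n}` with the elements of the
centralizer of those `t_{kl}` which commute with `t_{12}` (`exists_commutator_iff`). An element
which conjugates `t_{ij}(1)` to `t_{kl}(1)` conjugates `t_{ij}(α)` to `t_{kl}(α)` for all `α`;
so the identifications of the root subgroups are definable, and with
`[t_{12}(α), t_{2n}(β)] = t_{1n}(αβ)` also the multiplication of the field.
Finally, every element of `G` is a product of a bounded number of transvections
(`exists_forall_mem_transvections_pow`), and its entries can be followed along such a product by
column operations; this defines the isomorphism of `Δ(Γ(G))` onto `G`.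
-/

open scoped Matrix

/-! ### Transport of interpretations along automorphisms -/

namespace InterpretationCode.IsCoordinateMap

variable {L K : Language} {P ι : Type} {Γ : InterpretationCode L K P ι}
variable {A B : Type*} [L.Structure A] [K.Structure B] {p : P → B}

theorem equiv_comp {A' : Type*} [L.Structure A'] {μ : Γ.Domain p → A}
    (h : Γ.IsCoordinateMap p μ) (τ : L.Equiv A A') :
    Γ.IsCoordinateMap p (fun x => τ (μ x)) where
  surjective := τ.surjective.comp h.surjective
  eq_iff x y := (h.eq_iff x y).trans τ.injective.eq_iff.symm
  fn_iff f x y := by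
    rw [h.fn_iff, ← τ.injective.eq_iff, τ.map_fun]
    rfl
  rel_iff r x := by
    rw [h.rel_iff, ← τ.map_rel]
    rfl

/-- Two coordinate maps with the same parameters differ by an automorphism of the interpreted
structure. -/
theorem exists_equiv {μ μ' : Γ.Domain p → A} (h : Γ.IsCoordinateMap p μ)
    (h' : Γ.IsCoordinateMap p μ') : ∃ τ : L.Equiv A A, ∀ x, μ' x = τ (μ x) := by
  have key : ∀ x y, μ x = μ y ↔ μ' x = μ' y := fun x y => by
    rw [← h.eq_iff, ← h'.eq_iff]
  let g := Function.surjInv h.surjective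
  let g' := Function.surjInv h'.surjective
  have hg : ∀ a, μ (g a) = a := Function.surjInv_eq h.surjective
  have hg' : ∀ a, μ' (g' a) = a := Function.surjInv_eq h'.surjective
  have hfwd : ∀ x, μ' (g (μ x)) = μ' x := fun x => (key _ _).1 (hg _)
  have hbwd : ∀ x, μ (g' (μ' x)) = μ x := fun x => (key _ _).2 (hg' _)
  refine ⟨{ toFun := fun a => μ' (g a), invFun := fun a => μ (g' a), left_inv := fun a => ?_,
            right_inv := fun a => ?_, map_fun' := ?_, map_rel' := ?_ }, fun x => (hfwd x).symm⟩
  · simp only [hbwd, hg]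
  · simp only [hfwd, hg']
  · intro k f x
    have h1 := h.fn_iff f (fun j => g (x j)) (g (Language.Structure.funMap f x))
    have h2 := h1.symm.trans (h'.fn_iff f (fun j => g (x j)) (g (Language.Structure.funMap f x)))
    simp only [hg, true_iff] at h2
    exact h2.symm
  · intro k r x
    have h1 := h.rel_iff r (fun j => g (x j))
    have h2 := h1.symm.trans (h'.rel_iff r (fun j => g (x j)))
    simp only [hg] at h2
    exact h2.symm

end InterpretationCode.IsCoordinateMap

namespace InterpretationCode

variable {L K : Language} {P ι : Type} (Γ : InterpretationCode L K P ι)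
variable {A B B' : Type*} [L.Structure A] [K.Structure B] [K.Structure B'] {p : P → B}
  {p' : P → B'}

theorem dom_realize_equiv (σ : K.Equiv B B') (hp : ∀ i, p' i = σ (p i)) {x : ι → B} {x' : ι → B'}
    (hx : ∀ j, x' j = σ (x j)) :
    Γ.dom.Realize (Sum.elim p' x') ↔ Γ.dom.Realize (Sum.elim p x) := by
  rw [← Language.StrongHomClass.realize_formula σ]
  apply iff_of_eq
  congr 1
  funext i
  rcases i with i | i
  · exact hp i
  · exact hx i

/-- An isomorphism which maps the parameters `p` to `p'` carries `U_Γ(B', p')` back to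
`U_Γ(B, p)`. -/
def domainPullback (σ : K.Equiv B B') (hp : ∀ i, p' i = σ (p i)) (x : Γ.Domain p') :
    Γ.Domain p :=
  ⟨fun j => σ.symm (x.1 j), (Γ.dom_realize_equiv σ hp (fun j => by simp)).1 x.2⟩

theorem IsCoordinateMap.pullback {Γ : InterpretationCode L K P ι} {μ : Γ.Domain p → A}
    (h : Γ.IsCoordinateMap p μ) (σ : K.Equiv B B') (hp : ∀ i, p' i = σ (p i)) :
    Γ.IsCoordinateMap p' (fun x => μ (Γ.domainPullback σ hp x)) where
  surjective a := by
    obtain ⟨x, rfl⟩ := h.surjective a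
    exact ⟨⟨fun j => σ (x.1 j), (Γ.dom_realize_equiv σ hp (fun j => rfl)).2 x.2⟩,
      congrArg μ (Subtype.ext (funext fun j => σ.symm_apply_apply (x.1 j)))⟩
  eq_iff x y := by
    rw [← h.eq_iff, ← Language.StrongHomClass.realize_formula σ]
    apply iff_of_eq
    congr 1
    funext i
    rcases i with i | i | i
    · exact hp i
    · exact (σ.apply_symm_apply _).symm
    · exact (σ.apply_symm_apply _).symm
  fn_iff f x y := by
    rw [← h.fn_iff, ← Language.StrongHomClass.realize_formula σ]
    apply iff_of_eq
    congr 1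
    funext i
    rcases i with i | i | i
    · exact hp i
    · exact (σ.apply_symm_apply _).symm
    · exact (σ.apply_symm_apply _).symm
  rel_iff r x := by
    rw [← h.rel_iff, ← Language.StrongHomClass.realize_formula σ]
    apply iff_of_eq
    congr 1
    funext i
    rcases i with i | i
    · exact hp i
    · exact (σ.apply_symm_apply _).symm

end InterpretationCode

/-- If every tuple satisfying `φ` is the image of `p₀` under an automorphism in `S`, if `Δ` has no
parameters, and if `θA` and `θB` define the return isomorphisms for one choice of coordinate maps
`μ₀` and `ν₀` with the parameters `p₀` (up to the automorphisms in `S`), then all the other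
admissible parameters and coordinate maps behave in the same way. -/
def RegularBiInterpretation.ofOrbit {L K : Language} {A B : Type*} [L.Structure A] [K.Structure B]
    {P ι Q κ : Type} [Finite P] [Finite ι] [Finite Q] [Finite κ] [IsEmpty Q]
    (Γ : InterpretationCode L K P ι) (φ : K.Formula P) (Δ : InterpretationCode K L Q κ)
    (θA : L.Formula (Q ⊕ ((P × κ) ⊕ ((ι × κ) ⊕ Unit))))
    (θB : K.Formula (P ⊕ ((Q × ι) ⊕ ((κ × ι) ⊕ Unit))))
    (p₀ : P → B) (hp₀ : φ.Realize p₀) (S : Set (K.Equiv B B))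
    (orbit : ∀ p, φ.Realize p → ∃ σ ∈ S, ∀ i, p i = σ (p₀ i))
    (μ₀ : Γ.Domain p₀ → A) (hμ₀ : Γ.IsCoordinateMap p₀ μ₀)
    (q₀ : Q → A) (ν₀ : Δ.Domain q₀ → B) (hν₀ : Δ.IsCoordinateMap q₀ ν₀)
    (hθA : ∀ σ ∈ S, ∀ s : P → Δ.Domain q₀, (∀ i, ν₀ (s i) = σ (p₀ i)) →
      ∀ (u : ι → Δ.Domain q₀) (a : A),
        θA.Realize (Sum.elim q₀ (Sum.elim (fun ik => (s ik.1).1 ik.2)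
          (Sum.elim (fun jk => (u jk.1).1 jk.2) (fun _ => a)))) ↔
        ∃ x : Γ.Domain p₀, (∀ j, ν₀ (u j) = σ (x.1 j)) ∧ μ₀ x = a)
    (hθB : ∀ (s : Q → Γ.Domain p₀) (u : κ → Γ.Domain p₀) (b : B),
        θB.Realize (Sum.elim p₀ (Sum.elim (fun ik => (s ik.1).1 ik.2)
          (Sum.elim (fun jk => (u jk.1).1 jk.2) (fun _ => b)))) ↔
        ∃ x : Δ.Domain q₀, (∀ k, x.1 k = μ₀ (u k)) ∧ ν₀ x = b) :
    RegularBiInterpretation L K A B P ι Q κ where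
  Γ := Γ
  φ := φ
  Δ := Δ
  ψ := ⊤
  θA := θA
  θB := θB
  regular_left := ⟨⟨p₀, hp₀⟩, fun p hp => by
    obtain ⟨σ, -, hσ⟩ := orbit p hp
    exact ⟨_, hμ₀.pullback σ hσ⟩⟩
  regular_right := ⟨⟨q₀, by simp⟩, fun q _ => by
    obtain rfl := Subsingleton.elim q₀ q
    exact ⟨_, hν₀⟩⟩
  iso_left := by
    intro q _ ν hν s hs
    obtain rfl := Subsingleton.elim q₀ q
    obtain ⟨τ, hτ⟩ := hν₀.exists_equiv hν
    have hs₀ : φ.Realize (fun i => ν₀ (s i)) := by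
      rw [← Language.StrongHomClass.realize_formula τ]
      convert hs using 1
      exact funext fun i => (hτ _).symm
    obtain ⟨σ, hσS, hσ⟩ := orbit _ hs₀
    have hp : ∀ i, ν (s i) = (τ.comp σ) (p₀ i) := fun i => by
      rw [hτ, hσ]
      rfl
    refine ⟨_, hμ₀.pullback (τ.comp σ) hp, fun u a => ?_⟩
    rw [hθA σ hσS s hσ]
    constructor
    · rintro ⟨x, hx, rfl⟩
      have hu : ∀ j, ν (u j) = (τ.comp σ) (x.1 j) := fun j => by
        rw [hτ, hx]
        rfl
      refine ⟨(Γ.dom_realize_equiv _ hp hu).2 x.2, ?_⟩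
      congr 1
      refine Subtype.ext (funext fun j => ?_)
      exact (τ.comp σ).toEquiv.symm_apply_eq.2 (hu j)
    · rintro ⟨h, rfl⟩
      refine ⟨_, fun j => ?_, rfl⟩
      apply τ.injective
      rw [← hτ]
      exact ((τ.comp σ).apply_symm_apply _).symm
  iso_right := by
    intro p hp ν hν s _
    obtain ⟨σ, -, hσ⟩ := orbit p hp
    obtain ⟨τ, hτ⟩ := (hμ₀.pullback σ hσ).exists_equiv hν
    have hq : ∀ i, ν (s i) = τ (q₀ i) := fun i => isEmptyElim i
    refine ⟨_, (hν₀.pullback τ hq).equiv_comp σ, fun u b => ?_⟩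
    -- pull the situation back along `σ`, where `θB` is known to define the isomorphism
    have h1 := hθB (fun i => Γ.domainPullback σ hσ (s i)) (fun k => Γ.domainPullback σ hσ (u k))
      (σ.symm b)
    rw [← Language.StrongHomClass.realize_formula σ] at h1
    have h2 : (σ ∘ Sum.elim p₀ (Sum.elim
          (fun ik : Q × ι => (Γ.domainPullback σ hσ (s ik.1)).1 ik.2)
          (Sum.elim (fun jk : κ × ι => (Γ.domainPullback σ hσ (u jk.1)).1 jk.2)
            (fun _ : Unit => σ.symm b)))) =
        Sum.elim p (Sum.elim (fun ik => (s ik.1).1 ik.2)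
          (Sum.elim (fun jk => (u jk.1).1 jk.2) (fun _ => b))) := by
      funext i
      rcases i with i | i | i | i
      · exact (hσ i).symm
      · exact σ.apply_symm_apply _
      · exact σ.apply_symm_apply _
      · exact σ.apply_symm_apply _
    rw [h2] at h1
    rw [h1]
    constructor
    · rintro ⟨x, hx, hb⟩
      have hu : ∀ k, ν (u k) = τ (x.1 k) := fun k => by rw [hτ, hx]
      refine ⟨(Δ.dom_realize_equiv τ hq hu).2 x.2, ?_⟩
      have : Δ.domainPullback τ hq ⟨_, (Δ.dom_realize_equiv τ hq hu).2 x.2⟩ = x :=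
        Subtype.ext (funext fun j => τ.toEquiv.symm_apply_eq.2 (hu j))
      rw [this, hb]
      exact σ.apply_symm_apply _
    · rintro ⟨h, rfl⟩
      refine ⟨_, fun k => ?_, (σ.symm_apply_apply _).symm⟩
      exact τ.toEquiv.symm_apply_eq.2 (hτ _)

/-- A regular bi-interpretation is symmetric in the two structures. -/
def RegularBiInterpretation.symm {L K : Language} {A B : Type*} [L.Structure A] [K.Structure B]
    {P ι Q κ : Type} [Finite P] [Finite ι] [Finite Q] [Finite κ]
    (I : RegularBiInterpretation L K A B P ι Q κ) : RegularBiInterpretation K L B A Q κ P ι where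
  Γ := I.Δ
  φ := I.ψ
  Δ := I.Γ
  ψ := I.φ
  θA := I.θB
  θB := I.θA
  regular_left := I.regular_right
  regular_right := I.regular_left
  iso_left := I.iso_right
  iso_right := I.iso_left

/-! ### Parameter-free definability -/

section Definability

variable (L : Language) {M : Type*} [L.Structure M] {α β : Type*}

/-- The property `P` of tuples over `M` is defined by a formula without parameters. -/
def IsDefinable (P : (α → M) → Prop) : Prop :=
  ∃ φ : L.Formula α, ∀ v, φ.Realize v ↔ P v

/-- The function `f` of tuples over `M` is given by a term. -/
def IsTerm (f : (α → M) → M) : Prop :=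
  ∃ t : L.Term α, ∀ v, t.realize v = f v

variable {L}

namespace IsDefinable

theorem congr {P Q : (α → M) → Prop} (h : IsDefinable L P) (hPQ : ∀ v, P v ↔ Q v) :
    IsDefinable L Q :=
  h.imp fun _ hφ v => (hφ v).trans (hPQ v)

theorem const (p : Prop) : IsDefinable L (fun _ : α → M => p) := by
  by_cases hp : p
  · exact ⟨⊤, fun v => by simp [hp]⟩
  · exact ⟨⊥, fun v => by simp [hp]⟩

theorem not {P : (α → M) → Prop} (h : IsDefinable L P) : IsDefinable L (fun v => ¬ P v) := by
  obtain ⟨φ, hφ⟩ := h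
  exact ⟨φ.not, fun v => by rw [Language.Formula.realize_not, hφ]⟩

theorem and {P Q : (α → M) → Prop} (hP : IsDefinable L P) (hQ : IsDefinable L Q) :
    IsDefinable L (fun v => P v ∧ Q v) := by
  obtain ⟨φ, hφ⟩ := hP
  obtain ⟨ψ, hψ⟩ := hQ
  exact ⟨φ ⊓ ψ, fun v => by rw [Language.Formula.realize_inf, hφ, hψ]⟩

theorem imp {P Q : (α → M) → Prop} (hP : IsDefinable L P) (hQ : IsDefinable L Q) :
    IsDefinable L (fun v => P v → Q v) := by
  obtain ⟨φ, hφ⟩ := hP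
  obtain ⟨ψ, hψ⟩ := hQ
  exact ⟨φ.imp ψ, fun v => by rw [Language.Formula.realize_imp, hφ, hψ]⟩

theorem all [Finite β] {P : β → (α → M) → Prop} (h : ∀ b, IsDefinable L (P b)) :
    IsDefinable L (fun v => ∀ b, P b v) := by
  choose φ hφ using h
  exact ⟨Language.Formula.iInf φ, fun v => by simp [Language.Formula.realize_iInf, hφ]⟩

theorem any [Finite β] {P : β → (α → M) → Prop} (h : ∀ b, IsDefinable L (P b)) :
    IsDefinable L (fun v => ∃ b, P b v) :=
  (all fun b => (h b).not).not.congr fun v => by simp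

theorem exists_tuple [Finite β] {P : (α → M) → (β → M) → Prop}
    (h : IsDefinable L (fun w : α ⊕ β → M => P (fun i => w (.inl i)) (fun j => w (.inr j)))) :
    IsDefinable L (fun v => ∃ x, P v x) := by
  obtain ⟨φ, hφ⟩ := h
  exact ⟨φ.iExs β, fun v => by simp [Language.Formula.realize_iExs, hφ]⟩

theorem exists_elem {P : (α → M) → M → Prop}
    (h : IsDefinable L (fun w : α ⊕ Unit → M => P (fun i => w (.inl i)) (w (.inr ())))) :
    IsDefinable L (fun v => ∃ x, P v x) :=
  (exists_tuple (P := fun v (x : Unit → M) => P v (x ())) h).congr fun _ =>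
    ⟨fun ⟨_, hx⟩ => ⟨_, hx⟩, fun ⟨x, hx⟩ => ⟨fun _ => x, hx⟩⟩

theorem eq {f g : (α → M) → M} (hf : IsTerm L f) (hg : IsTerm L g) :
    IsDefinable L (fun v => f v = g v) := by
  obtain ⟨t, ht⟩ := hf
  obtain ⟨t', ht'⟩ := hg
  exact ⟨t.equal t', fun v => by simp [Language.Formula.realize_equal, ht, ht']⟩

end IsDefinable

namespace IsTerm

theorem var (i : α) : IsTerm L (fun v : α → M => v i) :=
  ⟨.var i, fun _ => rfl⟩

theorem weaken {f : (α → M) → M} (hf : IsTerm L f) :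
    IsTerm L (fun w : α ⊕ β → M => f (fun i => w (.inl i))) := by
  obtain ⟨t, ht⟩ := hf
  exact ⟨t.relabel Sum.inl, fun w => by rw [Language.Term.realize_relabel, ht]; rfl⟩

theorem ite_const (c : Prop) [Decidable c] {f g : (α → M) → M} (hf : IsTerm L f)
    (hg : IsTerm L g) : IsTerm L (fun v => if c then f v else g v) := by
  split_ifs
  · exact hf
  · exact hg

variable {F : Type*} [Field F]

theorem ring_zero : IsTerm Language.ring (fun _ : α → F => 0) := ⟨0, fun v => by simp⟩

theorem ring_one : IsTerm Language.ring (fun _ : α → F => 1) := ⟨1, fun v => by simp⟩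

theorem ring_add {f g : (α → F) → F} (hf : IsTerm Language.ring f) (hg : IsTerm Language.ring g) :
    IsTerm Language.ring (fun v => f v + g v) := by
  obtain ⟨t, ht⟩ := hf
  obtain ⟨t', ht'⟩ := hg
  exact ⟨t + t', fun v => by simp [ht, ht']⟩

theorem ring_mul {f g : (α → F) → F} (hf : IsTerm Language.ring f) (hg : IsTerm Language.ring g) :
    IsTerm Language.ring (fun v => f v * g v) := by
  obtain ⟨t, ht⟩ := hf
  obtain ⟨t', ht'⟩ := hg
  exact ⟨t * t', fun v => by simp [ht, ht']⟩

theorem ring_neg {f : (α → F) → F} (hf : IsTerm Language.ring f) :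
    IsTerm Language.ring (fun v => - f v) := by
  obtain ⟨t, ht⟩ := hf
  exact ⟨-t, fun v => by simp [ht]⟩

theorem ring_sum {f : β → (α → F) → F} (s : Finset β) (hf : ∀ b, IsTerm Language.ring (f b)) :
    IsTerm Language.ring (fun v => ∑ b ∈ s, f b v) := by
  classical
  induction s using Finset.induction_on with
  | empty => simpa using ring_zero
  | insert b s hb ih =>
    simp only [Finset.sum_insert hb]
    exact (hf b).ring_add ih

theorem ring_prod {f : β → (α → F) → F} (s : Finset β) (hf : ∀ b, IsTerm Language.ring (f b)) :
    IsTerm Language.ring (fun v => ∏ b ∈ s, f b v) := by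
  classical
  induction s using Finset.induction_on with
  | empty => simpa using ring_one
  | insert b s hb ih =>
    simp only [Finset.prod_insert hb]
    exact (hf b).ring_mul ih

theorem ring_det {n : Type*} [Fintype n] [DecidableEq n] {f : n → n → (α → F) → F}
    (hf : ∀ i j, IsTerm Language.ring (f i j)) :
    IsTerm Language.ring (fun v => (Matrix.of fun i j => f i j v).det) := by
  simp only [Matrix.det_apply]
  refine ring_sum _ fun σ => ?_
  have h := ring_prod (f := fun i v => f (σ i) i v) Finset.univ (fun i => hf (σ i) i)
  rcases Int.units_eq_one_or (Equiv.Perm.sign σ) with hs | hs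
  · simpa [hs] using h
  · simpa [hs] using h.ring_neg

variable {G : Type*} [Group G]

theorem group_one : IsTerm groupLanguage (fun _ : α → G => 1) :=
  ⟨.func (L := groupLanguage) (GroupFunc.one) ![], fun _ => rfl⟩

theorem group_mul {f g : (α → G) → G} (hf : IsTerm groupLanguage f) (hg : IsTerm groupLanguage g) :
    IsTerm groupLanguage (fun v => f v * g v) := by
  obtain ⟨t, ht⟩ := hf
  obtain ⟨t', ht'⟩ := hg
  refine ⟨.func (L := groupLanguage) (GroupFunc.mul) ![t, t'], fun v => ?_⟩
  exact congrArg₂ (· * ·) (ht v) (ht' v)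

theorem group_pow {f : (α → G) → G} (hf : IsTerm groupLanguage f) (m : ℕ) :
    IsTerm groupLanguage (fun v => f v ^ m) := by
  induction m with
  | zero => simpa using group_one
  | succ m ih => simpa only [pow_succ] using ih.group_mul hf

end IsTerm

end Definability

/-- A group automorphism as an automorphism for the language of groups. -/
def MulEquiv.groupLanguageEquiv {G : Type*} [Group G] (σ : G ≃* G) :
    groupLanguage.Equiv G G where
  toEquiv := σ.toEquiv
  map_fun' := by
    intro k f x
    cases f
    · exact map_mul σ _ _
    · exact map_inv σ _
    · exact map_one σ
  map_rel' := fun r => r.elim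

/-! ### Unipotent matrices -/

section Unipotent

variable {m : Type*} [Fintype m] [DecidableEq m]

theorem Matrix.isNilpotent_sub_one_of_pow_ringChar {F : Type*} [Field F] {x : Matrix m m F}
    (h0 : ringChar F ≠ 0) (hx : x ^ ringChar F = 1) : IsNilpotent (x - 1) := by
  have hp : Fact (ringChar F).Prime :=
    ⟨(CharP.char_is_prime_or_zero F (ringChar F)).resolve_right h0⟩
  rcases isEmpty_or_nonempty m with hm | hm
  · exact ⟨1, Subsingleton.elim _ _⟩
  refine ⟨ringChar F, ?_⟩
  rw [sub_pow_char_of_commute _ (Commute.one_right x), hx, one_pow, sub_self]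

/-- The elements of a finite set of nonzero field elements which is closed under squaring are
roots of unity, of an order which is bounded in terms of the size of the set. -/
theorem Finset.pow_factorial_eq_one_of_sq_mem {K : Type*} [Field K] {S : Finset K} {n : ℕ}
    (hn : S.card ≤ n) (h0 : (0 : K) ∉ S) (hsq : ∀ a ∈ S, a ^ 2 ∈ S) {a : K} (ha : a ∈ S) :
    a ^ (2 ^ n).factorial = 1 := by
  have hmem : ∀ i : ℕ, a ^ 2 ^ i ∈ S := fun i => by
    induction i with
    | zero => simpa using ha
    | succ i ih => rw [pow_succ, pow_mul]; exact hsq _ ih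
  have hcard : S.card < (Finset.range (n + 1)).card := by simpa using Nat.lt_succ_of_le hn
  obtain ⟨i, hi, j, hj, hij, he⟩ :=
    Finset.exists_ne_map_eq_of_card_lt_of_maps_to hcard (f := fun i => a ^ 2 ^ i)
      (fun i _ => hmem i)
  have ha0 : a ≠ 0 := fun h => h0 (h ▸ ha)
  simp only [Finset.mem_range] at hi hj
  have key : ∀ i j : ℕ, i < j → j ≤ n → a ^ 2 ^ i = a ^ 2 ^ j → a ^ (2 ^ n).factorial = 1 := by
    intro i j hlt hjn he
    have h1 : 2 ^ i < 2 ^ j := Nat.pow_lt_pow_right (by norm_num) hlt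
    have h2 : 2 ^ j ≤ 2 ^ n := Nat.pow_le_pow_right (by norm_num) hjn
    have h3 : a ^ (2 ^ j - 2 ^ i) = 1 := by
      rw [pow_sub₀ _ ha0 h1.le, he, mul_inv_cancel₀ (pow_ne_zero _ ha0)]
    obtain ⟨c, hc⟩ : 2 ^ j - 2 ^ i ∣ (2 ^ n).factorial :=
      Nat.dvd_factorial (Nat.sub_pos_of_lt h1) ((Nat.sub_le _ _).trans h2)
    rw [hc, pow_mul, h3, one_pow]
  rcases lt_or_gt_of_ne hij with h | h
  · exact key i j h (by omega) he
  · exact key j i h (by omega) he.symm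

theorem Matrix.isNilpotent_sub_one_of_spectrum {K : Type*} [Field K] [IsAlgClosed K]
    {x : Matrix m m K} (h : ∀ a ∈ spectrum K x, a = 1) : IsNilpotent (x - 1) := by
  have hroots : x.charpoly.roots = Multiset.replicate x.charpoly.roots.card 1 :=
    Multiset.eq_replicate_card.2 fun a ha =>
      h a (Matrix.mem_spectrum_iff_isRoot_charpoly.2 (Polynomial.isRoot_of_mem_roots ha))
  have hs := (IsAlgClosed.splits x.charpoly).eq_prod_roots
  rw [hroots, (Matrix.charpoly_monic x).leadingCoeff] at hs
  refine ⟨x.charpoly.roots.card, ?_⟩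
  have hc := Matrix.aeval_self_charpoly x
  rw [hs] at hc
  simpa using hc

/-- An invertible matrix which is conjugate to its square and to a suitable fixed power is
unipotent: squaring permutes its eigenvalues, so that they are roots of unity of bounded order. -/
theorem Matrix.isNilpotent_sub_one_of_conj {F : Type*} [Field F] {x : Matrix m m F} {n : ℕ}
    (hn : Fintype.card m ≤ n) (hx : IsUnit x) {g h : (Matrix m m F)ˣ} (hg : g * x = x ^ 2 * g)
    (hh : h * x = x ^ (2 ^ n).factorial * h) : IsNilpotent (x - 1) := by
  classical
  let K := AlgebraicClosure F
  let ρ : Matrix m m F →+* Matrix m m K := (algebraMap F K).mapMatrix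
  have hρ : Function.Injective ρ := Matrix.map_injective (algebraMap F K).injective
  rw [← IsNilpotent.map_iff hρ, map_sub, map_one]
  have hconj : ∀ (g : (Matrix m m F)ˣ) (k : ℕ), g * x = x ^ k * g →
      spectrum K (ρ x ^ k) = spectrum K (ρ x) := by
    intro g k hgk
    have h1 : ρ x ^ k = (Units.map ρ.toMonoidHom g : (Matrix m m K)ˣ) * ρ x *
        ((Units.map ρ.toMonoidHom g)⁻¹ : (Matrix m m K)ˣ) := by
      rw [Units.eq_mul_inv_iff_mul_eq]
      change _ * ρ g = ρ g * _
      rw [← map_pow, ← map_mul, ← map_mul, hgk]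
    rw [h1]
    exact spectrum.units_conjugate
  let S : Finset K := (ρ x).charpoly.roots.toFinset
  have hS : ∀ a, a ∈ S ↔ a ∈ spectrum K (ρ x) := fun a => by
    rw [Matrix.mem_spectrum_iff_isRoot_charpoly, Multiset.mem_toFinset,
      Polynomial.mem_roots (Matrix.charpoly_monic _).ne_zero]
  have hcard : S.card ≤ n := by
    refine (Multiset.toFinset_card_le _).trans ((Polynomial.card_roots' _).trans ?_)
    rwa [Matrix.charpoly_natDegree_eq_dim]
  have h0 : (0 : K) ∉ S := by
    rw [hS]
    exact spectrum.zero_notMem K (hx.map ρ)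
  have hsq : ∀ a ∈ S, a ^ 2 ∈ S := fun a ha => by
    rw [hS] at ha ⊢
    rw [← hconj g 2 hg]
    exact spectrum.pow_mem_pow _ _ ha
  apply Matrix.isNilpotent_sub_one_of_spectrum
  intro a ha
  rw [← hconj h _ hh, spectrum.map_pow_of_pos _ (Nat.factorial_pos _)] at ha
  obtain ⟨b, hb, rfl⟩ := ha
  exact Finset.pow_factorial_eq_one_of_sq_mem hcard h0 hsq ((hS b).2 hb)

end Unipotent

/-! ### Steinberg relations and rank one -/

/-- The family `p i j`, `i ≠ j`, satisfies the commutator relations of the elementary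
transvections `t_{ij}(1)`. The values `p i i` play no role. -/
structure IsSteinberg {ι G : Type*} [Group G] (p : ι → ι → G) : Prop where
  comm : ∀ i j k l, i ≠ j → k ≠ l → j ≠ k → i ≠ l → p i j * p k l = p k l * p i j
  rel : ∀ i j k, i ≠ j → j ≠ k → i ≠ k → p i j * p j k = p i k * (p j k * p i j)

namespace IsSteinberg

variable {F : Type*} [Field F] {n : ℕ} {p : Fin n → Fin n → Matrix.SpecialLinearGroup (Fin n) F}

/-- The subspace `W` is invariant under all `p i j` with `i < j`. -/
def Invariant (p : Fin n → Fin n → Matrix.SpecialLinearGroup (Fin n) F)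
    (W : Submodule F (Fin n → F)) : Prop :=
  ∀ i j, i < j → ∀ w, p i j • w ∈ W ↔ w ∈ W

theorem invariant_of_le {W : Submodule F (Fin n → F)}
    (h : ∀ i j, i < j → ∀ w ∈ W, p i j • w ∈ W) : Invariant p W := by
  intro i j hij w
  refine ⟨fun hw => ?_, h i j hij w⟩
  let f : (Fin n → F) →ₗ[F] (Fin n → F) := Matrix.toLin' (p i j).1
  have hf : Function.Injective f := fun v w hvw =>
    MulAction.injective (p i j) (by simpa [f, Matrix.SpecialLinearGroup.smul_def] using hvw)
  have hle : W.map f ≤ W := by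
    rintro _ ⟨v, hv, rfl⟩
    simpa [f, Matrix.SpecialLinearGroup.smul_def] using h i j hij v hv
  have heq : W.map f = W :=
    Submodule.eq_of_le_of_finrank_eq hle ((Submodule.equivMapOfInjective f hf W).finrank_eq.symm)
  rw [← heq] at hw
  obtain ⟨v, hv, hvw⟩ := hw
  have : v = w := MulAction.injective (p i j)
    (by simpa [f, Matrix.SpecialLinearGroup.smul_def] using hvw)
  exact this ▸ hv

/-- The linear map `g - 1`. -/
def delta (g : Matrix.SpecialLinearGroup (Fin n) F) : (Fin n → F) →ₗ[F] (Fin n → F) :=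
  Matrix.toLin' (g.1 - 1)

theorem delta_apply (g : Matrix.SpecialLinearGroup (Fin n) F) (v : Fin n → F) :
    delta g v = g • v - v := by
  simp [delta, Matrix.SpecialLinearGroup.smul_def]

/-- Kolchin's argument for the group generated by the `p i j` with `i < j`: on a nonzero invariant
subspace these unipotent elements act trivially modulo a proper invariant subspace. A maximal
proper invariant subspace will do: by descending induction on `j - i`, the element `p i j` is
central modulo elements which are known to act trivially. -/
theorem exists_invariant_lt (hp : IsSteinberg p)
    (hu : ∀ i j, i < j → IsNilpotent ((p i j).1 - 1)) {W : Submodule F (Fin n → F)}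
    (hW : Invariant p W) (hW0 : W ≠ ⊥) :
    ∃ U < W, Invariant p U ∧ ∀ i j, i < j → ∀ w ∈ W, delta (p i j) w ∈ U := by
  obtain ⟨U, ⟨hUW, hU⟩, hmax⟩ := (wellFounded_gt (α := Submodule F (Fin n → F))).has_min
    {U | U < W ∧ Invariant p U} ⟨⊥, bot_lt_iff_ne_bot.2 hW0,
      fun i j _ w => by simp [smul_eq_zero_iff_eq]⟩
  refine ⟨U, hUW, hU, ?_⟩
  have main : ∀ d : ℕ, ∀ i j : Fin n, i < j → n ≤ d + (j - i : ℕ) →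
      ∀ w ∈ W, delta (p i j) w ∈ U := by
    intro d
    induction d with
    | zero =>
      intro i j hij hd
      omega
    | succ d ih =>
      intro i j hij hd
      by_contra hcon
      push Not at hcon
      obtain ⟨w₀, hw₀, hw₀U⟩ := hcon
      let x := p i j
      let U' := U ⊔ W.map (delta x)
      have hin : ∀ w ∈ W, x • w - w ∈ U' := fun w hw =>
        Submodule.mem_sup_right ⟨w, hw, delta_apply _ _⟩
      have hUx : ∀ u ∈ U, delta x u ∈ U := fun u hu => by
        rw [delta_apply]
        exact U.sub_mem ((hU i j hij u).2 hu) hu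
      have hU'W : U' ≤ W := by
        refine sup_le hUW.le ?_
        rintro _ ⟨w, hw, rfl⟩
        rw [delta_apply]
        exact W.sub_mem ((hW i j hij w).2 hw) hw
      have hinv : Invariant p U' := by
        apply invariant_of_le
        intro r s hrs w' hw'
        obtain ⟨u, hu, v, ⟨w, hw, rfl⟩, rfl⟩ := Submodule.mem_sup.1 hw'
        rw [smul_add]
        refine U'.add_mem (Submodule.mem_sup_left ((hU r s hrs u).2 hu)) ?_
        have hrw : p r s • w ∈ W := (hW r s hrs w).2 hw
        rw [delta_apply, smul_sub]
        by_cases hjr : j = r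
        · subst hjr
          -- `p i j` and `p j s` commute modulo `p i s`
          have h1 : x • p j s • w = p i s • p j s • x • w := by
            simp only [smul_smul]
            rw [show x * p j s = _ from hp.rel i j s hij.ne hrs.ne (hij.trans hrs).ne]
          have hc : p i s • p j s • x • w - p j s • x • w ∈ U := by
            have := ih i s (hij.trans hrs) (by omega) (p j s • x • w)
              ((hW j s hrs _).2 ((hW i j hij _).2 hw))
            rwa [delta_apply] at this
          have h2 := U'.sub_mem (hin _ hrw) (Submodule.mem_sup_left hc)
          rw [h1] at h2
          convert h2 using 1
          abel
        · by_cases hsi : s = i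
          · subst hsi
            have h1 : p r s • x • w = p r j • x • p r s • w := by
              simp only [smul_smul]
              rw [show p r s * x = _ from hp.rel r s j hrs.ne hij.ne (hrs.trans hij).ne]
            have hc : p r j • x • p r s • w - x • p r s • w ∈ U := by
              have := ih r j (hrs.trans hij) (by omega) (x • p r s • w)
                ((hW s j hij _).2 hrw)
              rwa [delta_apply] at this
            have h2 := U'.add_mem (hin _ hrw) (Submodule.mem_sup_left hc)
            rw [h1]
            convert h2 using 1
            abel
          · have h1 : p r s • x • w = x • p r s • w := by
              simp only [smul_smul]
              rw [show x * p r s = _ from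
                hp.comm i j r s hij.ne hrs.ne hjr (fun h => hsi h.symm)]
            rw [h1]
            exact hin _ hrw
      -- otherwise `W = U + (x - 1) W`, and iteration gives `W = U`, as `x - 1` is nilpotent
      have hlt : U' < W := by
        refine lt_of_le_of_ne hU'W fun heq => hUW.not_ge ?_
        have hk : ∀ k : ℕ, W ≤ U ⊔ W.map (delta x ^ k) := by
          intro k
          induction k with
          | zero => exact le_sup_of_le_right (by simp [Module.End.one_eq_id])
          | succ k ihk =>
            intro w hw
            obtain ⟨u, hu, v, ⟨w', hw', rfl⟩, rfl⟩ := Submodule.mem_sup.1 (ihk hw)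
            rw [← heq] at hw'
            obtain ⟨u', hu', v', ⟨w'', hw'', rfl⟩, rfl⟩ := Submodule.mem_sup.1 hw'
            have hku : ∀ l : ℕ, (delta x ^ l) u' ∈ U := by
              intro l
              induction l with
              | zero => simpa using hu'
              | succ l ihl =>
                rw [pow_succ', Module.End.mul_apply]
                exact hUx _ ihl
            rw [map_add, ← add_assoc]
            refine Submodule.add_mem _ (Submodule.mem_sup_left (U.add_mem hu (hku k)))
              (Submodule.mem_sup_right ⟨w'', hw'', ?_⟩)
            rw [pow_succ, Module.End.mul_apply]
        obtain ⟨k, hk0⟩ := hu i j hij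
        have hz : delta x ^ k = 0 := by
          rw [delta, ← Matrix.toLin'_pow, hk0, map_zero]
        simpa [hz] using hk k
      refine hmax U' ⟨hlt, hinv⟩ (lt_of_le_of_ne le_sup_left fun heq => hw₀U ?_)
      rw [heq]
      exact Submodule.mem_sup_right ⟨w₀, hw₀, rfl⟩
  intro i j hij
  exact main n i j hij (by omega)

/-- Iterating `exists_invariant_lt` gives a descending chain of invariant subspaces whose dimensions
drop at least by one in each step until they reach `0`. -/
theorem exists_chain (hp : IsSteinberg p) (hu : ∀ i j, i < j → IsNilpotent ((p i j).1 - 1)) :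
    ∃ W : ℕ → Submodule F (Fin n → F), W 0 = ⊤ ∧ ∀ k, Invariant p (W k) ∧
      Module.finrank F (W k) ≤ n - k ∧
      ∀ i j, i < j → ∀ w ∈ W k, delta (p i j) w ∈ W (k + 1) := by
  have step : ∀ W : {W // Invariant p W}, ∃ U : {U // Invariant p U},
      Module.finrank F U.1 ≤ Module.finrank F W.1 - 1 ∧
      ∀ i j, i < j → ∀ w ∈ W.1, delta (p i j) w ∈ U.1 := by
    rintro ⟨W, hW⟩
    by_cases hW0 : W = ⊥
    · subst hW0
      refine ⟨⟨⊥, hW⟩, by simp, fun i j _ w hw => ?_⟩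
      have : w = 0 := by simpa using hw
      simp [this]
    · obtain ⟨U, hlt, hU, h⟩ := exists_invariant_lt hp hu hW hW0
      have := Submodule.finrank_lt_finrank_of_lt hlt
      exact ⟨⟨U, hU⟩, by simp only; omega, h⟩
  -- truncated subtraction: once the chain has reached `⊥`, it stays there
  choose next hnext using step
  let W : ℕ → {W // Invariant p W} := fun k =>
    Nat.rec ⟨⊤, fun i j _ w => by simp⟩ (fun _ U => next U) k
  have hdim : ∀ k, Module.finrank F (W k).1 ≤ n - k := by
    intro k
    induction k with
    | zero => simp [W]
    | succ k ih =>
      have := (hnext (W k)).1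
      change Module.finrank F (next (W k)).1 ≤ _
      omega
  exact ⟨fun k => (W k).1, rfl, fun k => ⟨(W k).2, hdim k, (hnext (W k)).2⟩⟩

/-- The element `p i j` with `i` first and `j` last in the order of the indices is an iterated
commutator of length `n - 1`; therefore `p i j - 1` maps everything into the last nonzero term of
the chain of invariant subspaces, and its rank is at most `1`. -/
theorem exists_vecMulVec_of_extreme (hp : IsSteinberg p)
    (hu : ∀ i j, i < j → IsNilpotent ((p i j).1 - 1)) {i j : Fin n} (hij : (j : ℕ) = i + (n - 1))
    (hn : 2 ≤ n) : ∃ a f : Fin n → F, (p i j).1 - 1 = Matrix.vecMulVec a f := by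
  obtain ⟨W, hW0, hW⟩ := exists_chain hp hu
  have main : ∀ h : ℕ, ∀ i j : Fin n, (j : ℕ) = i + (h + 1) → ∀ k, ∀ w ∈ W k,
      delta (p i j) w ∈ W (k + (h + 1)) := by
    intro h
    induction h with
    | zero =>
      intro i j hij k w hw
      exact (hW k).2.2 i j (by rw [Fin.lt_def]; omega) w hw
    | succ h ih =>
      intro i j hij k w hw
      obtain ⟨m, hm⟩ : ∃ m : Fin n, (m : ℕ) = i + (h + 1) := ⟨⟨i + (h + 1), by omega⟩, rfl⟩
      have him : i < m := by rw [Fin.lt_def]; omega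
      have hmj : m < j := by rw [Fin.lt_def]; omega
      -- write `w` as the image of a vector under `p m j * p i m`
      obtain ⟨v, rfl⟩ : ∃ v, p m j • p i m • v = w :=
        ⟨(p i m)⁻¹ • (p m j)⁻¹ • w, by simp only [smul_inv_smul]⟩
      have hv : v ∈ W k := ((hW k).1 i m him v).1 (((hW k).1 m j hmj _).1 hw)
      have hrel : p i j • p m j • p i m • v = p i m • p m j • v := by
        simp only [smul_smul]
        rw [hp.rel i m j him.ne hmj.ne (him.trans hmj).ne]
      have key : delta (p i j) (p m j • p i m • v) =
          delta (p i m) (delta (p m j) v) - delta (p m j) (delta (p i m) v) := by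
        simp only [delta_apply, hrel, smul_sub]
        abel
      rw [key]
      refine Submodule.sub_mem _ ?_ ?_
      · have := ih i m hm _ _ ((hW k).2.2 m j hmj v hv)
        rwa [show k + 1 + (h + 1) = k + (h + 1 + 1) by ring] at this
      · exact (hW _).2.2 m j hmj _ (ih i m hm k v hv)
  have hdim : Module.finrank F (W (n - 1)) ≤ 1 := (hW (n - 1)).2.1.trans (by omega)
  obtain ⟨a, ha⟩ := finrank_le_one_iff.1 hdim
  have hcol : ∀ l : Fin n, ∃ c : F, c • a.1 = delta (p i j) (Pi.single l 1) := fun l => by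
    have h1 := main (n - 2) i j (by omega) 0 (Pi.single l 1) (by simp [hW0])
    rw [show 0 + (n - 2 + 1) = n - 1 by omega] at h1
    obtain ⟨c, hc⟩ := ha ⟨_, h1⟩
    exact ⟨c, congrArg Subtype.val hc⟩
  choose f hf using hcol
  refine ⟨a.1, f, ?_⟩
  ext r l
  have := congrFun (hf l) r
  simp only [delta, Matrix.toLin'_apply, Matrix.mulVec_single_one, Pi.smul_apply,
    smul_eq_mul] at this
  rw [Matrix.vecMulVec_apply, mul_comm, this]
  rfl

end IsSteinberg

theorem Equiv.exists_perm_apply_eq {ι : Type*} [DecidableEq ι] {a b i j : ι} (hab : a ≠ b)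
    (hij : i ≠ j) : ∃ e : Equiv.Perm ι, e a = i ∧ e b = j := by
  refine ⟨(Equiv.swap a i).trans (Equiv.swap (Equiv.swap a i b) j), ?_, by simp⟩
  have h : i ≠ Equiv.swap a i b := fun h => hab (by
    have := congrArg (Equiv.swap a i) h
    simpa using this)
  simp [Equiv.swap_apply_of_ne_of_ne h hij]

namespace IsSteinberg

theorem comp_perm {ι G : Type*} [Group G] {p : ι → ι → G} (hp : IsSteinberg p)
    (e : Equiv.Perm ι) : IsSteinberg (fun i j => p (e i) (e j)) where
  comm _ _ _ _ h1 h2 h3 h4 := hp.comm _ _ _ _ (e.injective.ne h1) (e.injective.ne h2)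
    (e.injective.ne h3) (e.injective.ne h4)
  rel _ _ _ h1 h2 h3 := hp.rel _ _ _ (e.injective.ne h1) (e.injective.ne h2) (e.injective.ne h3)

theorem exists_vecMulVec {F : Type*} [Field F] {n : ℕ}
    {p : Fin n → Fin n → Matrix.SpecialLinearGroup (Fin n) F} (hn : 2 ≤ n) (hp : IsSteinberg p)
    (hu : ∀ i j, i ≠ j → IsNilpotent ((p i j).1 - 1)) {i j : Fin n} (hij : i ≠ j) :
    ∃ a f : Fin n → F, (p i j).1 - 1 = Matrix.vecMulVec a f := by
  have hab : (⟨0, by omega⟩ : Fin n) ≠ ⟨n - 1, by omega⟩ := by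
    simp only [ne_eq, Fin.mk.injEq]
    omega
  obtain ⟨e, rfl, rfl⟩ := Equiv.exists_perm_apply_eq hab hij
  exact (hp.comp_perm e).exists_vecMulVec_of_extreme
    (fun i j h => hu _ _ (e.injective.ne h.ne)) (by simp) hn

end IsSteinberg

/-- If `y` has rank one, then `x * y * z = 0` only if `x * y = 0` or `y * z = 0`. -/
theorem Matrix.mul_mul_ne_zero_of_vecMulVec {m F : Type*} [Fintype m] [Field F]
    {x y z : Matrix m m F} (hy : ∃ a f : m → F, y = Matrix.vecMulVec a f) (hxy : x * y ≠ 0)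
    (hyz : y * z ≠ 0) : x * y * z ≠ 0 := by
  obtain ⟨a, f, rfl⟩ := hy
  rw [Matrix.mul_vecMulVec] at hxy ⊢
  rw [Matrix.vecMulVec_mul] at hyz ⊢
  rw [ne_eq, Matrix.vecMulVec_eq_zero, not_or] at *
  exact ⟨hxy.1, hyz.2⟩

/-! ### Matrix units -/

section SteinbergType

variable {ι R : Type*} [Ring R] {N : ι → ι → R}

/-- The product rules for the off-diagonal matrix units. -/
structure IsMatrixUnits (N : ι → ι → R) : Prop where
  zero : ∀ i j k l, i ≠ j → k ≠ l → j ≠ k → N i j * N k l = 0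
  mul : ∀ i j k, i ≠ j → j ≠ k → i ≠ k → N i j * N j k = N i k

/-- Suppose that each triple of indices satisfies either the product rules of the matrix units
`e_{ij}`, or those of `-e_{ji}`. If the products behave as for elements of rank one, then all the
triples are of the same type. -/
theorem isMatrixUnits_or
    (hz : ∀ i j k l, i ≠ j → k ≠ l → j ≠ k → i ≠ l → N i j * N k l = 0)
    (hne : ∀ i j, i ≠ j → N i j ≠ 0)
    (hmid : ∀ i j, i ≠ j → ∀ x y, x * N i j ≠ 0 → N i j * y ≠ 0 → x * N i j * y ≠ 0)
    (ht : ∀ i j k, i ≠ j → j ≠ k → i ≠ k → (N i j * N j k = N i k ∧ N j k * N i j = 0) ∨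
      (N i j * N j k = 0 ∧ N j k * N i j = - N i k)) :
    IsMatrixUnits N ∨ (∀ i j k l, i ≠ j → k ≠ l → j ≠ k → N k l * N i j = 0) ∧
      ∀ i j k, i ≠ j → j ≠ k → i ≠ k → N j k * N i j = - N i k := by
  let Q : ι → ι → ι → Prop := fun i j k => N i j * N j k = N i k ∧ N j k * N i j = 0
  have hQ : ∀ i j k, i ≠ j → j ≠ k → i ≠ k → ¬ Q i j k →
      N i j * N j k = 0 ∧ N j k * N i j = - N i k := fun i j k h1 h2 h3 h =>
    (ht i j k h1 h2 h3).resolve_left h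
  have contra : ∀ {i j : ι} {x : R}, i ≠ j → x = N i j → x ≠ 0 :=
    fun h hx => hx ▸ hne _ _ h
  have rot : ∀ i j k, i ≠ j → j ≠ k → i ≠ k → Q i j k → Q j k i := by
    intro i j k h1 h2 h3 h
    by_contra hc
    obtain ⟨a1, a2⟩ := hQ j k i h2 h3.symm h1.symm hc
    have e1 : N j i = - (N k i * N j k) := by rw [a2, neg_neg]
    rcases ht k i j h3.symm h1 h2.symm with ⟨b1, b2⟩ | ⟨b1, b2⟩
    · rcases ht k j i h2.symm h1.symm h3.symm with ⟨c1, -⟩ | ⟨-, c2⟩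
      · refine hne k i h3.symm ?_
        rw [← c1, ← b1, e1, mul_assoc, mul_neg, ← mul_assoc (N i j), b2, zero_mul, neg_zero,
          mul_zero]
      · refine hne k i h3.symm (neg_eq_zero.1 ?_)
        rw [← c2, ← b1, e1, neg_mul, mul_assoc, ← mul_assoc (N j k), a1, zero_mul, mul_zero,
          neg_zero]
    · have e2 : N k j = - (N i j * N k i) := by rw [b2, neg_neg]
      rcases ht k j i h2.symm h1.symm h3.symm with ⟨c1, -⟩ | ⟨-, c2⟩
      · refine hne k i h3.symm ?_
        rw [← c1, e1, e2, neg_mul_neg, mul_assoc, ← mul_assoc (N k i),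
          hz k i k i h3.symm h3.symm h3 h3.symm, zero_mul, mul_zero]
      · refine hne k i h3.symm (neg_eq_zero.1 ?_)
        rw [← c2, e1, e2, neg_mul_neg, mul_assoc, ← mul_assoc (N j k), h.2, zero_mul, mul_zero]
  have rev : ∀ i j k, i ≠ j → j ≠ k → i ≠ k → Q i j k → Q k j i := by
    intro i j k h1 h2 h3 h
    have hr := rot i j k h1 h2 h3 h
    have hr' := rot j k i h2 h3.symm h1.symm hr
    by_contra hc
    obtain ⟨-, a2⟩ := hQ k j i h2.symm h1.symm h3.symm hc
    refine hne k i h3.symm (neg_eq_zero.1 ?_)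
    rw [← a2, ← hr.1, ← hr'.1, mul_assoc, ← mul_assoc (N k i),
      hz k i k i h3.symm h3.symm h3 h3.symm, zero_mul, mul_zero]
  have last : ∀ i j k l, i ≠ j → j ≠ k → i ≠ k → j ≠ l → i ≠ l → Q i j k → Q i j l := by
    intro i j k l h1 h2 h3 h4 h5 h
    by_contra hc
    obtain ⟨-, a2⟩ := hQ i j l h1 h4 h5 hc
    refine hmid i j h1 (N j l) (N j k) ?_ ?_ ?_
    · rw [a2]; exact neg_ne_zero.2 (hne _ _ h5)
    · exact contra h3 h.1
    · rw [mul_assoc, h.1, hz j l i k h4 h3 h5.symm h2]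
  have swap : ∀ i j k, i ≠ j → j ≠ k → i ≠ k → Q i j k → Q i k j := by
    intro i j k h1 h2 h3 h
    exact rot j i k h1.symm h3 h2 (rot k j i h2.symm h1.symm h3.symm (rev i j k h1 h2 h3 h))
  have all : ∀ i j k, i ≠ j → j ≠ k → i ≠ k → Q i j k →
      ∀ a b c, a ≠ b → b ≠ c → a ≠ c → Q a b c := by
    intro i j k h1 h2 h3 h a b c hab hbc hac
    obtain ⟨j', k', g1, g2, g3, g⟩ : ∃ j' k', a ≠ j' ∧ j' ≠ k' ∧ a ≠ k' ∧ Q a j' k' := by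
      by_cases e1 : a = i
      · exact ⟨j, k, e1 ▸ h1, h2, e1 ▸ h3, e1 ▸ h⟩
      by_cases e2 : a = j
      · exact ⟨k, i, e2 ▸ h2, h3.symm, e2 ▸ h1.symm, e2 ▸ rot i j k h1 h2 h3 h⟩
      have h' : Q i j a := by
        by_cases e3 : a = k
        · exact e3 ▸ h
        · exact last i j k a h1 h2 h3 (Ne.symm e2) (Ne.symm e1) h
      exact ⟨i, j, e1, h1, e2, rot j a i (Ne.symm e2) e1 h1.symm
        (rot i j a h1 (Ne.symm e2) (Ne.symm e1) h')⟩
    obtain ⟨k', g1, g2, g⟩ : ∃ k', a ≠ k' ∧ b ≠ k' ∧ Q a b k' := by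
      by_cases e1 : b = j'
      · exact ⟨k', g3, e1 ▸ g2, e1 ▸ g⟩
      · exact ⟨j', g1, e1, swap a j' b g1 (Ne.symm e1) hab
          (last a j' k' b g1 g2 g3 (Ne.symm e1) hab g)⟩
    exact last a b k' c hab g2 g1 hbc hac g
  by_cases hex : ∃ i j k, i ≠ j ∧ j ≠ k ∧ i ≠ k ∧ Q i j k
  · obtain ⟨i, j, k, h1, h2, h3, h⟩ := hex
    have hall := all i j k h1 h2 h3 h
    refine Or.inl ⟨fun a b c d hab hcd hbc => ?_,
      fun a b c hab hbc hac => (hall a b c hab hbc hac).1⟩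
    by_cases had : a = d
    · subst had
      exact (hall c a b hcd hab hbc.symm).2
    · exact hz a b c d hab hcd hbc had
  · have hall : ∀ i j k, i ≠ j → j ≠ k → i ≠ k → ¬ Q i j k := fun i j k h1 h2 h3 h =>
      hex ⟨i, j, k, h1, h2, h3, h⟩
    refine Or.inr ⟨fun a b c d hab hcd hbc => ?_, fun a b c hab hbc hac =>
      (hQ a b c hab hbc hac (hall a b c hab hbc hac)).2⟩
    by_cases had : a = d
    · subst had
      exact (hQ c a b hcd hab hbc.symm (hall c a b hcd hab hbc.symm)).1
    · exact hz c d a b hcd hab (Ne.symm had) hbc.symm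

end SteinbergType

/-- A nonzero system of `n × n` matrices which multiply like the off-diagonal matrix units is
conjugate to them. -/
theorem IsMatrixUnits.exists_conj {F : Type*} [Field F] {n : ℕ} (hn : 3 ≤ n)
    {N : Fin n → Fin n → Matrix (Fin n) (Fin n) F} (hN : IsMatrixUnits N)
    (hne : ∀ i j, i ≠ j → N i j ≠ 0) :
    ∃ g : (Matrix (Fin n) (Fin n) F)ˣ, ∀ i j, i ≠ j → N i j * g.1 = g.1 * Matrix.single i j 1 := by
  obtain ⟨o, a, b, hoa, hab, hob⟩ : ∃ o a b : Fin n, o ≠ a ∧ a ≠ b ∧ o ≠ b :=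
    ⟨⟨0, by omega⟩, ⟨1, by omega⟩, ⟨2, by omega⟩, by simp, by simp, by simp⟩
  -- the conjugating matrix has the columns `v o = N o a w` and `v i = N i o (v o)`
  obtain ⟨w, hw⟩ : ∃ w, N o a *ᵥ w ≠ 0 := by
    by_contra! h
    exact hne o a hoa (Matrix.ext_of_mulVec_single fun i => by rw [h, Matrix.zero_mulVec])
  let v : Fin n → Fin n → F := fun i => if i = o then N o a *ᵥ w else N i o *ᵥ (N o a *ᵥ w)
  have hvo : v o = N o a *ᵥ w := if_pos rfl
  have hv : ∀ i, i ≠ o → v i = N i o *ᵥ (N o a *ᵥ w) := fun i hi => if_neg hi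
  have hzero : ∀ i j k, i ≠ j → j ≠ k → N i j *ᵥ v k = 0 := by
    intro i j k hij hjk
    by_cases hk : k = o
    · subst hk
      rw [hvo, Matrix.mulVec_mulVec, hN.zero i j k a hij hoa hjk, Matrix.zero_mulVec]
    · rw [hv k hk, Matrix.mulVec_mulVec, hN.zero i j k o hij hk hjk, Matrix.zero_mulVec]
  have hmul : ∀ i k, i ≠ k → N i k *ᵥ v k = v i := by
    intro i k hik
    by_cases hk : k = o
    · subst hk
      rw [hvo, hv i hik]
    rw [hv k hk]
    by_cases hi : i = o
    · subst hi
      rw [hvo]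
      simp only [Matrix.mulVec_mulVec]
      congr 1
      by_cases hka : k = a
      · subst hka
        rw [← hN.mul k b i hab hob.symm hik.symm, ← mul_assoc, ← mul_assoc,
          hN.mul i k b hik hab hob, mul_assoc, hN.mul b i k hob.symm hik hab.symm,
          hN.mul i b k hob hab.symm hik]
      · rw [hN.mul k i a hk hoa hka, hN.mul i k a hik hka hoa]
    · rw [hv i hi, Matrix.mulVec_mulVec, hN.mul i k o hik hk hi]
  have hv0 : ∀ i, v i ≠ 0 := by
    intro i hi
    by_cases h : i = o
    · subst h
      exact hw (hvo ▸ hi)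
    · have := hmul o i (Ne.symm h)
      rw [hi, Matrix.mulVec_zero, hvo] at this
      exact hw this.symm
  have : Nontrivial (Fin n) := ⟨o, a, hoa⟩
  have hli : LinearIndependent F v := by
    rw [Fintype.linearIndependent_iff]
    intro c hc j
    obtain ⟨i, hij⟩ := exists_ne j
    have h := congrArg (N i j *ᵥ ·) hc
    simp only [Matrix.mulVec_sum, Matrix.mulVec_zero, Matrix.mulVec_smul] at h
    rw [Finset.sum_eq_single j (fun k _ hk => by rw [hzero i j k hij hk.symm, smul_zero])
      (fun h => absurd (Finset.mem_univ j) h), hmul i j hij] at h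
    exact (smul_eq_zero.1 h).resolve_right (hv0 i)
  let g : Matrix (Fin n) (Fin n) F := Matrix.of fun r k => v k r
  have hg : IsUnit g := by
    rw [← Matrix.linearIndependent_cols_iff_isUnit]
    exact hli
  refine ⟨hg.unit, fun i j hij => Matrix.ext_of_mulVec_single fun k => ?_⟩
  have hgk : ∀ k, g *ᵥ Pi.single k 1 = v k := fun k => by
    rw [Matrix.mulVec_single_one]
    rfl
  rw [IsUnit.unit_spec, ← Matrix.mulVec_mulVec, ← Matrix.mulVec_mulVec, hgk]
  by_cases hjk : j = k
  · subst hjk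
    rw [hmul i j hij, Matrix.mulVec_single_one, ← hgk i]
    congr 1
    ext r
    simp [Matrix.single_apply, Pi.single_apply, eq_comm]
  · rw [hzero i j k hij hjk, Matrix.mulVec_single_one]
    have : (Matrix.single i j (1 : F)).col k = 0 := by
      ext r
      simp [hjk]
    rw [this, Matrix.mulVec_zero]

/-! ### Automorphisms of the special linear group -/

section Automorphisms

variable {m F : Type*} [Fintype m] [DecidableEq m] [Field F]

/-- Conjugation by an invertible matrix, as an automorphism of the special linear group. -/
def Matrix.SpecialLinearGroup.conjEquiv (g : (Matrix m m F)ˣ) :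
    Matrix.SpecialLinearGroup m F ≃* Matrix.SpecialLinearGroup m F where
  toFun x := ⟨g * x.1 * (g⁻¹ : (Matrix m m F)ˣ), by rw [Matrix.det_units_conj, x.2]⟩
  invFun x := ⟨(g⁻¹ : (Matrix m m F)ˣ) * x.1 * g, by rw [Matrix.det_units_conj', x.2]⟩
  left_inv x := Subtype.ext (by simp [mul_assoc])
  right_inv x := Subtype.ext (by simp [mul_assoc])
  map_mul' x y := Subtype.ext (by
    change g.1 * (x.1 * y.1) * g.inv = g.1 * x.1 * g.inv * (g.1 * y.1 * g.inv)
    simp only [mul_assoc, Units.inv_mul_cancel_left, Units.inv_eq_val_inv])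

theorem Matrix.SpecialLinearGroup.transpose_inv (x : Matrix.SpecialLinearGroup m F) :
    x.transpose⁻¹ = x⁻¹.transpose :=
  Subtype.ext (Matrix.adjugate_transpose x.1).symm

/-- The inverse transpose, as an automorphism of the special linear group. -/
def Matrix.SpecialLinearGroup.invTransposeEquiv :
    Matrix.SpecialLinearGroup m F ≃* Matrix.SpecialLinearGroup m F where
  toFun x := x⁻¹.transpose
  invFun x := x⁻¹.transpose
  left_inv x := by simp only [transpose_inv, inv_inv]; rfl
  right_inv x := by simp only [transpose_inv, inv_inv]; rfl
  map_mul' x y := Subtype.ext (by simp)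

/-- Families in `SL_n(F)`, `n ≥ 3`, which consist of nontrivial unipotent elements and satisfy the
Steinberg relations are the images of the elementary transvections under automorphisms. -/
theorem IsSteinberg.exists_mulEquiv {n : ℕ} (hn : 3 ≤ n)
    {p : Fin n → Fin n → Matrix.SpecialLinearGroup (Fin n) F} (hp : IsSteinberg p)
    (hne : ∀ i j, i ≠ j → p i j ≠ 1) (hu : ∀ i j, i ≠ j → IsNilpotent ((p i j).1 - 1)) :
    ∃ σ : Matrix.SpecialLinearGroup (Fin n) F ≃* Matrix.SpecialLinearGroup (Fin n) F,
      ∀ (i j : Fin n) (hij : i ≠ j) (α : F),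
        (σ (Matrix.SpecialLinearGroup.transvection hij α)).1 = 1 + α • ((p i j).1 - 1) := by
  let N : Fin n → Fin n → Matrix (Fin n) (Fin n) F := fun i j => (p i j).1 - 1
  have hpN : ∀ i j, (p i j).1 = 1 + N i j := fun i j => (add_sub_cancel _ _).symm
  have hN0 : ∀ i j, i ≠ j → N i j ≠ 0 := fun i j h h0 =>
    hne i j h (Subtype.ext (sub_eq_zero.1 h0))
  have hmid : ∀ i j, i ≠ j → ∀ x y, x * N i j ≠ 0 → N i j * y ≠ 0 → x * N i j * y ≠ 0 :=
    fun i j h x y =>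
      Matrix.mul_mul_ne_zero_of_vecMulVec (hp.exists_vecMulVec (by omega) hu h)
  have hsq : ∀ i j, i ≠ j → N i j * N i j = 0 := by
    intro i j h
    by_contra hc
    obtain ⟨k, hk⟩ := hu i j h
    have hpow : ∀ l : ℕ, N i j ^ (l + 1) ≠ 0 := by
      intro l
      induction l with
      | zero => simpa using hN0 i j h
      | succ l ih =>
        rw [pow_succ, pow_succ]
        exact hmid i j h _ _ (by rwa [← pow_succ]) hc
    exact hpow k (by rw [pow_succ, hk, zero_mul])
  have hz : ∀ i j k l, i ≠ j → k ≠ l → j ≠ k → i ≠ l → N i j * N k l = 0 := by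
    intro i j k l h1 h2 h3 h4
    have hc : N i j * N k l = N k l * N i j := by
      have := congrArg Subtype.val (hp.comm i j k l h1 h2 h3 h4)
      simp only [Matrix.SpecialLinearGroup.coe_mul, hpN] at this
      have h5 : (1 + N i j) * (1 + N k l) = 1 + N i j + N k l + N i j * N k l := by noncomm_ring
      have h6 : (1 + N k l) * (1 + N i j) = 1 + N i j + N k l + N k l * N i j := by noncomm_ring
      rw [h5, h6] at this
      exact add_left_cancel this
    by_contra h0
    refine hmid k l h2 (N i j) (N i j) h0 (hc ▸ h0) ?_
    rw [mul_assoc, ← hc, ← mul_assoc, hsq i j h1, zero_mul]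
  have ht : ∀ i j k, i ≠ j → j ≠ k → i ≠ k → (N i j * N j k = N i k ∧ N j k * N i j = 0) ∨
      (N i j * N j k = 0 ∧ N j k * N i j = - N i k) := by
    intro i j k h1 h2 h3
    have hc : N i j * N j k = N j k * N i j + N i k := by
      have := congrArg Subtype.val (hp.rel i j k h1 h2 h3)
      simp only [Matrix.SpecialLinearGroup.coe_mul, hpN] at this
      have h5 : (1 + N i j) * (1 + N j k) = 1 + N i j + N j k + N i j * N j k := by noncomm_ring
      have h6 : (1 + N i k) * ((1 + N j k) * (1 + N i j)) = 1 + N i j + N j k +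
          (N j k * N i j + N i k) + N i k * N i j + N i k * N j k * (1 + N i j) := by noncomm_ring
      rw [h5, h6, hz i k i j h3 h1 h3.symm h1, hz i k j k h3 h2 h2.symm h3, zero_mul, add_zero,
        add_zero] at this
      exact add_left_cancel this
    have hor : N i j * N j k = 0 ∨ N j k * N i j = 0 := by
      by_contra! h
      refine hmid j k h2 _ _ h.1 h.2 ?_
      have h7 : N i j * (N i j * N j k) = 0 := by rw [← mul_assoc, hsq i j h1, zero_mul]
      rw [hc, mul_add, hz i j i k h1 h3 h1.symm h3, add_zero, ← mul_assoc] at h7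
      exact h7
    rcases hor with h | h
    · right
      refine ⟨h, ?_⟩
      rw [h] at hc
      exact eq_neg_of_add_eq_zero_left hc.symm
    · left
      rw [h, zero_add] at hc
      exact ⟨hc, h⟩
  rcases isMatrixUnits_or hz hN0 hmid ht with hM | ⟨hM0, hM⟩
  · obtain ⟨g, hg⟩ := hM.exists_conj hn hN0
    refine ⟨Matrix.SpecialLinearGroup.conjEquiv g, fun i j hij α => ?_⟩
    change (g : Matrix (Fin n) (Fin n) F) * (1 + Matrix.single i j α) * _ = _
    rw [Units.mul_inv_eq_iff_eq_mul, add_mul, mul_add, smul_mul_assoc, hg i j hij,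
      ← mul_smul_comm, Matrix.smul_single, smul_eq_mul, mul_one, one_mul, mul_one]
  · -- the negative transposes are matrix units
    have hM' : IsMatrixUnits (fun i j => - (N i j).transpose) := by
      refine ⟨fun i j k l h1 h2 h3 => ?_, fun i j k h1 h2 h3 => ?_⟩
      · rw [neg_mul_neg, ← Matrix.transpose_mul, hM0 i j k l h1 h2 h3, Matrix.transpose_zero]
      · rw [neg_mul_neg, ← Matrix.transpose_mul, hM i j k h1 h2 h3, Matrix.transpose_neg]
    obtain ⟨g, hg⟩ := hM'.exists_conj hn (fun i j h => by simpa using hN0 i j h)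
    refine ⟨(Matrix.SpecialLinearGroup.conjEquiv g).trans
      Matrix.SpecialLinearGroup.invTransposeEquiv, fun i j hij α => ?_⟩
    have h1 : ∀ β : F, (Matrix.SpecialLinearGroup.conjEquiv g
        (Matrix.SpecialLinearGroup.transvection hij β)).1 = 1 - β • (N i j).transpose := by
      intro β
      change (g : Matrix (Fin n) (Fin n) F) * (1 + Matrix.single i j β) * _ = _
      rw [Units.mul_inv_eq_iff_eq_mul, sub_eq_add_neg, ← smul_neg, add_mul, mul_add,
        smul_mul_assoc, hg i j hij, ← mul_smul_comm, Matrix.smul_single, smul_eq_mul, mul_one,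
        one_mul, mul_one]
    change ((Matrix.SpecialLinearGroup.conjEquiv g
      (Matrix.SpecialLinearGroup.transvection hij α))⁻¹).1.transpose = _
    rw [← map_inv, Matrix.SpecialLinearGroup.transvection_inv, h1]
    simp [N]

end Automorphisms

/-! ### Transvections -/

open scoped Pointwise

namespace Matrix.SpecialLinearGroup

section Transvections

variable {m F : Type*} [Fintype m] [DecidableEq m] [Field F]

theorem transvection_val {i j : m} (hij : i ≠ j) (a : F) :
    (transvection hij a).1 = 1 + a • Matrix.single i j 1 := by
  rw [transvection_coe, Matrix.smul_single, smul_eq_mul, mul_one]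

theorem transvection_injective {i j : m} (hij : i ≠ j) :
    Function.Injective (transvection hij : F → SpecialLinearGroup m F) := by
  intro a b h
  have := congrFun (congrFun (congrArg Subtype.val h) i) j
  simpa [transvection_coe, hij] using this

theorem transvection_mul_apply {i j : m} (hij : i ≠ j) (a : F) (x : SpecialLinearGroup m F)
    (r c : m) : (transvection hij a * x).1 r c = x.1 r c + if r = i then a * x.1 j c else 0 := by
  change (Matrix.transvection i j a * x.1) r c = _
  by_cases h : r = i
  · subst h
    simp
  · simp [h]

theorem mul_transvection_apply {i j : m} (hij : i ≠ j) (a : F) (x : SpecialLinearGroup m F)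
    (r c : m) : (x * transvection hij a).1 r c = x.1 r c + if c = j then a * x.1 r i else 0 := by
  change (x.1 * Matrix.transvection i j a) r c = _
  by_cases h : c = j
  · subst h
    simp
  · simp [h]

theorem transvection_comm {i j k l : m} (hij : i ≠ j) (hkl : k ≠ l) (hjk : j ≠ k) (hil : i ≠ l)
    (a b : F) :
    transvection hij a * transvection hkl b = transvection hkl b * transvection hij a := by
  apply Subtype.ext
  simp only [coe_mul, transvection_coe, mul_add, add_mul, mul_one, one_mul,
    Matrix.single_mul_single_of_ne _ _ _ _ hjk, Matrix.single_mul_single_of_ne _ _ _ _ hil.symm]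
  abel

theorem transvection_rel {i j k : m} (hij : i ≠ j) (hjk : j ≠ k) (hik : i ≠ k) (a b : F) :
    transvection hij a * transvection hjk b =
      transvection hik (a * b) * (transvection hjk b * transvection hij a) := by
  apply Subtype.ext
  simp only [coe_mul, transvection_coe, mul_add, add_mul, mul_one, one_mul,
    Matrix.single_mul_single_same, Matrix.single_mul_single_of_ne _ _ _ _ hik.symm,
    Matrix.single_mul_single_of_ne _ _ _ _ hjk.symm, mul_zero]
  abel

/-- An element which conjugates `t_{ij}(1)` to `t_{kl}(1)` conjugates `t_{ij}(α)` to
`t_{kl}(α)` for all `α`. -/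
theorem mul_transvection_of_conj {i j k l : m} {hij : i ≠ j} {hkl : k ≠ l}
    {g : SpecialLinearGroup m F} (hg : g * transvection hij 1 = transvection hkl 1 * g) (a : F) :
    g * transvection hij a = transvection hkl a * g := by
  have h := congrArg Subtype.val hg
  simp only [coe_mul, transvection_val, mul_add, add_mul, mul_one, one_mul, one_smul,
    add_right_inj] at h
  apply Subtype.ext
  simp only [coe_mul, transvection_val, mul_add, add_mul, mul_one, one_mul, mul_smul_comm,
    smul_mul_assoc, h]

/-- With a third index at hand, all the nontrivial transvections are conjugate: a monomial matrix
conjugates one to the other, and its determinant can be adjusted at the third index. -/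
theorem exists_conj_transvection {i j k l t : m} (hij : i ≠ j) (hkl : k ≠ l) (hti : t ≠ i)
    (htj : t ≠ j) {a b : F} (ha : a ≠ 0) (hb : b ≠ 0) :
    ∃ g : SpecialLinearGroup m F, g * transvection hij a = transvection hkl b * g := by
  obtain ⟨e, hei, hej⟩ := Equiv.exists_perm_apply_eq hij hkl
  let s : F := ((Equiv.Perm.sign e⁻¹ : ℤ) : F)
  have hs : s * s = 1 := by
    rcases Int.units_eq_one_or (Equiv.Perm.sign e⁻¹) with h | h <;> simp [s, h]
  let c : F := s * (a * b⁻¹)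
  let d : m → F := fun x => (if x = i then b * a⁻¹ else 1) * (if x = t then c else 1)
  have hdet : ((e⁻¹).permMatrix F * Matrix.diagonal d).det = 1 := by
    rw [Matrix.det_mul, Matrix.det_permutation, Matrix.det_diagonal, Finset.prod_mul_distrib,
      Finset.prod_ite_eq', Finset.prod_ite_eq']
    simp only [Finset.mem_univ, if_true, c]
    change s * (b * a⁻¹ * (s * (a * b⁻¹))) = 1
    calc _ = (s * s) * (a⁻¹ * a) * (b * b⁻¹) := by ring
      _ = 1 := by rw [hs, inv_mul_cancel₀ ha, mul_inv_cancel₀ hb]; norm_num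
  let g : SpecialLinearGroup m F := ⟨_, hdet⟩
  have hg : ∀ x y, g.1 x y = if x = e y then d y else 0 := by
    intro x y
    change ((e⁻¹).permMatrix F * Matrix.diagonal d) x y = _
    rw [Matrix.mul_diagonal]
    simp only [Equiv.Perm.permMatrix, PEquiv.toMatrix_apply, Equiv.toPEquiv_apply,
      Option.mem_some_iff]
    by_cases h : x = e y
    · simp [h]
    · have : ¬ e.symm x = y := fun h' => h (by rw [← h', Equiv.apply_symm_apply])
      simp [h, this]
  have hdi : d i = b * a⁻¹ := by simp [d, hti.symm]
  have hdj : d j = 1 := by simp [d, hij.symm, htj.symm]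
  refine ⟨g, Subtype.ext ?_⟩
  ext x y
  rw [mul_transvection_apply, transvection_mul_apply]
  simp only [hg, hei]
  congr 1
  by_cases hy : y = j
  · subst hy
    by_cases hx : x = k
    · subst hx
      simp only [if_true, hdi, hdj, hej]
      field_simp
    · simp [hx]
  · have : ¬ l = e y := fun h => hy (e.injective (by rw [← h, hej]))
    simp [hy, this]

/-- The centralizer of the transvections `t_{kl}` which commute with `t_{ij}` consists of
the scalar multiples of the elements of `T_{ij}`. -/
theorem eq_of_commute_transvections {i j t : m} (hij : i ≠ j) (hti : t ≠ i) (htj : t ≠ j)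
    {x : SpecialLinearGroup m F}
    (h : ∀ (k l : m) (hkl : k ≠ l), l ≠ i → k ≠ j →
      x * transvection hkl 1 = transvection hkl 1 * x) :
    ∃ c a : F, c ≠ 0 ∧ x.1 = c • (1 + a • Matrix.single i j 1) := by
  have hent : ∀ k l : m, k ≠ l → l ≠ i → k ≠ j → ∀ r c,
      (if c = l then x.1 r k else 0) = if r = k then x.1 l c else 0 := by
    intro k l hkl hli hkj r c
    have := congrFun (congrFun (congrArg Subtype.val (h k l hkl hli hkj)) r) c
    rw [mul_transvection_apply, transvection_mul_apply] at this
    simpa using this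
  have hcol : ∀ k l : m, k ≠ l → l ≠ i → k ≠ j → ∀ r, r ≠ k → x.1 r k = 0 := by
    intro k l h1 h2 h3 r hr
    simpa [hr] using hent k l h1 h2 h3 r l
  have hrow : ∀ k l : m, k ≠ l → l ≠ i → k ≠ j → ∀ c, c ≠ l → x.1 l c = 0 := by
    intro k l h1 h2 h3 c hc
    simpa [hc] using (hent k l h1 h2 h3 k c).symm
  have hdiag : ∀ k, x.1 k k = x.1 i i := by
    intro k
    by_cases hk : k = i
    · rw [hk]
    · simpa using (hent i k (Ne.symm hk) hk hij i k).symm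
  have hoff : ∀ r c, r ≠ c → ¬ (r = i ∧ c = j) → x.1 r c = 0 := by
    intro r c hrc hne
    by_cases hc : c = j
    · subst hc
      have hri : r ≠ i := fun h => hne ⟨h, rfl⟩
      by_cases hrt : r = t
      · subst hrt
        exact hrow i r hti.symm hti hij c hrc.symm
      · exact hrow t r (Ne.symm hrt) hri htj c hrc.symm
    · by_cases hct : c = t
      · subst hct
        exact hcol c j htj hij.symm htj r hrc
      · exact hcol c t hct hti hc r hrc
  have hc0 : x.1 i i ≠ 0 := by
    intro h0
    have : x.1.det = 0 := Matrix.det_eq_zero_of_column_eq_zero i fun r => by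
      by_cases hr : r = i
      · rw [hr, h0]
      · exact hoff r i hr fun h => hr h.1
    exact one_ne_zero (x.2.symm.trans this)
  refine ⟨x.1 i i, (x.1 i i)⁻¹ * x.1 i j, hc0, ?_⟩
  ext r c
  by_cases hrc : r = c
  · subst hrc
    have : ¬ (i = r ∧ j = r) := fun h => hij (h.1.trans h.2.symm)
    simp [hdiag r, this]
  · by_cases hh : r = i ∧ c = j
    · obtain ⟨rfl, rfl⟩ := hh
      simp [hij, mul_inv_cancel_left₀ hc0]
    · have : ¬ (i = r ∧ j = c) := fun h => hh ⟨h.1.symm, h.2.symm⟩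
      simp [hoff r c hrc hh, hrc, this]

/-- A definition of the root subgroup `T_{ik}` from the elements `t_{kl}(1)`: it is obtained by
taking commutators with `t_{jk}(1)`, which removes the scalars from the centralizer which defines
`T_{ij}`. -/
theorem exists_commutator_iff {i j k : m} (hij : i ≠ j) (hjk : j ≠ k) (hik : i ≠ k)
    (x : SpecialLinearGroup m F) :
    (∃ y : SpecialLinearGroup m F, (∀ (r c : m) (hrc : r ≠ c), c ≠ i → r ≠ j →
        y * transvection hrc 1 = transvection hrc 1 * y) ∧
      y * transvection hjk 1 = x * (transvection hjk 1 * y)) ↔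
    ∃ a : F, x = transvection hik a := by
  constructor
  · rintro ⟨y, hy, hxy⟩
    obtain ⟨c, a, -, hca⟩ := eq_of_commute_transvections hij hik.symm hjk.symm hy
    refine ⟨a, ?_⟩
    have hrel := congrArg Subtype.val (transvection_rel hij hjk hik a 1)
    have h2 : y * transvection hjk 1 =
        transvection hik a * (transvection hjk 1 * y) := by
      apply Subtype.ext
      rw [← transvection_val hij] at hca
      rw [mul_one] at hrel
      simp only [coe_mul] at hrel ⊢
      rw [hca, smul_mul_assoc, hrel, mul_smul_comm, mul_smul_comm]
    exact mul_right_cancel (hxy.symm.trans h2)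
  · rintro ⟨a, rfl⟩
    refine ⟨transvection hij a, fun r c hrc hci hrj =>
      transvection_comm hij hrc hrj.symm hci.symm a 1, ?_⟩
    rw [transvection_rel hij hjk hik, mul_one]

end Transvections

/-! ### Bounded generation by transvections -/

section Generation

variable {n : ℕ} {F : Type*} [Field F]

/-- The set of all elementary transvections, including the identity. -/
def transvections (n : ℕ) (F : Type*) [Field F] : Set (SpecialLinearGroup (Fin n) F) :=
  {x | ∃ (i j : Fin n) (hij : i ≠ j) (a : F), x = transvection hij a}

theorem one_mem_transvections (hn : 2 ≤ n) : 1 ∈ transvections n F :=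
  ⟨⟨0, by omega⟩, ⟨1, by omega⟩, by simp, 0, (transvection_coeff_zero _).symm⟩

/-- The columns of `x` with a number below `k` are those of the identity matrix. -/
def HasUnitColumns (k : ℕ) (x : SpecialLinearGroup (Fin n) F) : Prop :=
  ∀ c : Fin n, (c : ℕ) < k → ∀ r, x.1 r c = if r = c then 1 else 0

theorem HasUnitColumns.transvection_mul {k : ℕ} {x : SpecialLinearGroup (Fin n) F}
    (hx : HasUnitColumns k x) {i j : Fin n} (hij : i ≠ j) (hj : k ≤ j) (a : F) :
    HasUnitColumns k (transvection hij a * x) := by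
  intro c hc r
  have : ¬ j = c := fun h => by subst h; omega
  rw [transvection_mul_apply, hx c hc, hx c hc]
  simp [this]

theorem HasUnitColumns.exists_clear {k : Fin n} {x : SpecialLinearGroup (Fin n) F}
    (hx : HasUnitColumns k x) (hk : x.1 k k = 1) :
    ∃ y ∈ transvections n F ^ (n - 1), HasUnitColumns (k + 1) (y * x) := by
  have key : ∀ A : Finset (Fin n), k ∉ A → ∃ y ∈ transvections n F ^ A.card, ∀ r c,
      (y * x).1 r c = x.1 r c - if r ∈ A then x.1 r k * x.1 k c else 0 := by
    intro A
    induction A using Finset.induction_on with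
    | empty => exact fun _ => ⟨1, by simp, by simp⟩
    | insert a A ha ih =>
      intro hkA
      rw [Finset.mem_insert, not_or] at hkA
      obtain ⟨y, hy, hyx⟩ := ih hkA.2
      refine ⟨transvection (Ne.symm hkA.1) (- x.1 a k) * y, ?_, fun r c => ?_⟩
      · rw [Finset.card_insert_of_notMem ha, pow_succ']
        exact Set.mul_mem_mul ⟨_, _, _, _, rfl⟩ hy
      · rw [mul_assoc, transvection_mul_apply, hyx, hyx]
        by_cases hr : r = a
        · subst hr
          simp [ha, hkA.2, sub_eq_add_neg]
        · simp [hr]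
  obtain ⟨y, hy, hyx⟩ := key (Finset.univ.erase k) (Finset.notMem_erase k _)
  rw [Finset.card_erase_of_mem (Finset.mem_univ k), Finset.card_univ, Fintype.card_fin] at hy
  refine ⟨y, hy, fun c hc r => ?_⟩
  rw [hyx]
  simp only [Finset.mem_erase, Finset.mem_univ, and_true]
  rcases Nat.lt_succ_iff_lt_or_eq.1 hc with h | h
  · have hkc : ¬ k = c := fun h' => by subst h'; omega
    rw [hx c h, hx c h]
    simp [hkc]
  · obtain rfl : c = k := Fin.ext h
    by_cases hr : r = c
    · subst hr
      simp [hk]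
    · simp [hr, hk]

/-- In a matrix with the first `k` columns of the identity matrix, the column with the number `k`
has a nonzero entry on or below the diagonal. -/
theorem HasUnitColumns.exists_ne_zero {k : Fin n} {x : SpecialLinearGroup (Fin n) F}
    (hx : HasUnitColumns k x) : ∃ r, k ≤ r ∧ x.1 r k ≠ 0 := by
  by_contra! h
  have hmul : x⁻¹.1 * x.1 = 1 := by rw [← coe_mul, inv_mul_cancel, coe_one]
  have hinv : ∀ r, r < k → x⁻¹.1 k r = 0 := by
    intro r hr
    have h1 := congrFun (congrFun hmul k) r
    rw [Matrix.mul_apply, Matrix.one_apply_ne hr.ne'] at h1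
    simpa [hx r hr] using h1
  have h1 := congrFun (congrFun hmul k) k
  rw [Matrix.mul_apply, Matrix.one_apply_eq] at h1
  refine zero_ne_one ((Finset.sum_eq_zero fun r _ => ?_).symm.trans h1)
  rcases lt_or_ge r k with hr | hr
  · rw [hinv r hr, zero_mul]
  · rw [h r hr, mul_zero]

theorem HasUnitColumns.exists_pivot {k : Fin n} {x : SpecialLinearGroup (Fin n) F}
    (hx : HasUnitColumns k x) (hk : (k : ℕ) + 1 < n) :
    ∃ y ∈ transvections n F ^ 2, HasUnitColumns k (y * x) ∧ (y * x).1 k k = 1 := by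
  have step : ∀ x : SpecialLinearGroup (Fin n) F, HasUnitColumns k x →
      (∃ r, k < r ∧ x.1 r k ≠ 0) →
      ∃ y ∈ transvections n F, HasUnitColumns k (y * x) ∧ (y * x).1 k k = 1 := by
    rintro x hx ⟨r, hkr, hr⟩
    refine ⟨transvection hkr.ne ((1 - x.1 k k) * (x.1 r k)⁻¹), ⟨_, _, _, _, rfl⟩,
      hx.transvection_mul _ hkr.le _, ?_⟩
    rw [transvection_mul_apply]
    simp [mul_assoc, inv_mul_cancel₀ hr]
  rw [pow_two]
  by_cases h : ∃ r, k < r ∧ x.1 r k ≠ 0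
  · obtain ⟨y, hy, h1⟩ := step x hx h
    exact ⟨y, Set.mem_mul.2 ⟨y, hy, 1, one_mem_transvections (by omega), mul_one y⟩, h1⟩
  · push Not at h
    obtain ⟨r, hkr, hr⟩ := hx.exists_ne_zero
    have hkk : x.1 k k ≠ 0 := by
      rcases hkr.eq_or_lt with rfl | hlt
      · exact hr
      · exact absurd (h r hlt) hr
    have hlt : k < ⟨k + 1, hk⟩ := Fin.lt_def.2 (Nat.lt_succ_self _)
    obtain ⟨y, hy, h1⟩ := step (transvection hlt.ne' 1 * x) (hx.transvection_mul _ le_rfl _)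
      ⟨⟨k + 1, hk⟩, hlt, by rw [transvection_mul_apply, h _ hlt]; simpa using hkk⟩
    rw [← mul_assoc] at h1
    exact ⟨_, Set.mul_mem_mul hy ⟨_, _, _, _, rfl⟩, h1⟩

theorem HasUnitColumns.apply_last {k : Fin n} {x : SpecialLinearGroup (Fin n) F}
    (hx : HasUnitColumns k x) (hk : (k : ℕ) + 1 = n) : x.1 k k = 1 := by
  have hlt : ∀ c : Fin n, c ≠ k → (c : ℕ) < k := fun c hc => by
    have := Fin.val_ne_of_ne hc
    omega
  have htri : x.1.IsUpperTriangular := fun r c hcr => by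
    simp only [id] at hcr
    have h1 : c < k := lt_of_lt_of_le hcr (Fin.le_def.2 (by omega))
    rw [hx c h1, if_neg hcr.ne']
  have hdet := Matrix.det_of_isUpperTriangular htri
  rw [x.2, Finset.prod_eq_single k (fun c _ hc => by rw [hx c (hlt c hc), if_pos rfl])
    (fun h => absurd (Finset.mem_univ k) h)] at hdet
  exact hdet.symm

/-- Gaussian elimination: `SL_n(F)` is generated by transvections in a bounded number of steps. -/
theorem exists_forall_mem_transvections_pow (hn : 2 ≤ n) (F : Type*) [Field F] :
    ∃ N : ℕ, ∀ x : SpecialLinearGroup (Fin n) F, x ∈ transvections n F ^ N := by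
  have h1 : (1 : SpecialLinearGroup (Fin n) F) ∈ transvections n F := one_mem_transvections hn
  have key : ∀ k : ℕ, k ≤ n → ∃ N : ℕ, ∀ x : SpecialLinearGroup (Fin n) F,
      ∃ y ∈ transvections n F ^ N, HasUnitColumns k (y * x) := by
    intro k
    induction k with
    | zero => exact fun _ => ⟨0, fun x => ⟨1, by simp, fun c hc => absurd hc (Nat.not_lt_zero _)⟩⟩
    | succ k ih =>
      intro hk
      obtain ⟨N, hN⟩ := ih (by omega)
      refine ⟨n - 1 + 2 + N, fun x => ?_⟩
      obtain ⟨y, hy, hyx⟩ := hN x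
      obtain ⟨z, hz, hzx, hzk⟩ : ∃ z ∈ transvections n F ^ 2,
          HasUnitColumns (⟨k, hk⟩ : Fin n) (z * (y * x)) ∧
            (z * (y * x)).1 ⟨k, hk⟩ ⟨k, hk⟩ = 1 := by
        rcases hk.eq_or_lt with h | h
        · refine ⟨1, ?_, by rwa [one_mul], ?_⟩
          · rw [pow_two]
            exact Set.mem_mul.2 ⟨1, h1, 1, h1, mul_one 1⟩
          · rw [one_mul]
            exact HasUnitColumns.apply_last (k := ⟨k, hk⟩) hyx h
        · exact HasUnitColumns.exists_pivot (k := ⟨k, hk⟩) hyx h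
      obtain ⟨w, hw, hwx⟩ := hzx.exists_clear hzk
      refine ⟨w * z * y, ?_, by rwa [mul_assoc, mul_assoc]⟩
      rw [pow_add, pow_add]
      exact Set.mul_mem_mul (Set.mul_mem_mul hw hz) hy
  obtain ⟨N, hN⟩ := key n le_rfl
  refine ⟨N, fun x => ?_⟩
  obtain ⟨y, hy, hyx⟩ := hN x⁻¹
  have : y * x⁻¹ = 1 := Subtype.ext (by
    ext r c
    rw [hyx c c.2 r, coe_one, Matrix.one_apply])
  rwa [mul_inv_eq_one.1 this] at hy

end Generation

end Matrix.SpecialLinearGroup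

/-! ### The field inside the group -/

open Matrix.SpecialLinearGroup

section GroupPredicates

variable {n : ℕ} (hn : 3 ≤ n)

/-- The pair `(1, n)`, which indexes the root subgroup carrying the field. -/
def cornerIndex : {ij : Fin n × Fin n // ij.1 ≠ ij.2} :=
  ⟨(⟨0, by omega⟩, ⟨n - 1, by omega⟩), by simp only [ne_eq, Fin.mk.injEq]; omega⟩

/-- The pair `(1, 2)`. -/
def rowIndex : {ij : Fin n × Fin n // ij.1 ≠ ij.2} :=
  ⟨(⟨0, by omega⟩, ⟨1, by omega⟩), by simp⟩

/-- The pair `(2, n)`. -/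
def colIndex : {ij : Fin n × Fin n // ij.1 ≠ ij.2} :=
  ⟨(⟨1, by omega⟩, ⟨n - 1, by omega⟩), by simp only [ne_eq, Fin.mk.injEq]; omega⟩

section Group

variable {G : Type*} [Group G] (p : {ij : Fin n × Fin n // ij.1 ≠ ij.2} → G)

/-- `x` belongs to the root subgroup `T_{1n}` which is determined by the parameters `p`. -/
def IsRoot (x : G) : Prop :=
  ∃ y, (∀ a : {ij : Fin n × Fin n // ij.1 ≠ ij.2}, a.1.2 ≠ (rowIndex hn).1.1 →
      a.1.1 ≠ (rowIndex hn).1.2 → y * p a = p a * y) ∧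
    y * p (colIndex hn) = x * (p (colIndex hn) * y)

/-- `z` is the product of the elements `x` and `y` of the field `T_{1n}`: the commutator of a
conjugate of `x` in `T_{12}` and a conjugate of `y` in `T_{2n}`. -/
def IsFieldMul (x y z : G) : Prop :=
  ∃ g h x' y', g * p (cornerIndex hn) = p (rowIndex hn) * g ∧
    h * p (cornerIndex hn) = p (colIndex hn) * h ∧ g * x = x' * g ∧ h * y = y' * h ∧
    x' * y' = z * (y' * x')

/-- For `a = (i, j)`, the elements `x` and `y` are `t_{ij}(α)` and `t_{1n}(α)` for some `α`. -/
def IsRootLink (a : {ij : Fin n × Fin n // ij.1 ≠ ij.2}) (x y : G) : Prop :=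
  ∃ g, g * p a = p (cornerIndex hn) * g ∧ g * x = y * g ∧ IsRoot hn p y

/-- `x` is a product of `k` transvections, and `u` is the matrix of its entries, as elements of the
field `T_{1n}`. Multiplication by a transvection from the right is a column operation. -/
def IsEntryMatrix : ℕ → ({ij : Fin n × Fin n // ij.1 ≠ ij.2} → G) → (Fin n × Fin n → G) → G → Prop
  | 0, p, u, x => x = 1 ∧ ∀ rc, u rc = if rc.1 = rc.2 then p (cornerIndex hn) else 1
  | k + 1, p, u, x => ∃ (a : {ij : Fin n × Fin n // ij.1 ≠ ij.2}) (u' : Fin n × Fin n → G)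
      (w : Fin n → G) (x' y b : G), IsEntryMatrix k p u' x' ∧ IsRootLink hn p a y b ∧ x = x' * y ∧
        (∀ r, IsFieldMul hn p b (u' (r, a.1.1)) (w r)) ∧
        ∀ rc, u rc = u' rc * if rc.2 = a.1.2 then w rc.1 else 1

/-- `p` consists of nontrivial elements and satisfies the Steinberg relations. If the characteristic
`q` is positive, then the elements have order dividing `q`; if `q = 0`, then they are conjugate to
their powers with the exponents `2` and `(2 ^ n)!`. -/
def IsTransvectionTuple (q : ℕ) : Prop :=
  (∀ a b : {ij : Fin n × Fin n // ij.1 ≠ ij.2}, a.1.2 ≠ b.1.1 → a.1.1 ≠ b.1.2 →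
    p a * p b = p b * p a) ∧
  (∀ a b c : {ij : Fin n × Fin n // ij.1 ≠ ij.2}, a.1.2 = b.1.1 → c.1.1 = a.1.1 →
    c.1.2 = b.1.2 → p a * p b = p c * (p b * p a)) ∧
  ∀ a, ¬ p a = 1 ∧ p a ^ q = 1 ∧ (q = 0 → (∃ g, g * p a = p a ^ 2 * g) ∧
    ∃ g, g * p a = p a ^ (2 ^ n).factorial * g)

end Group

section Definable

variable {G α : Type*} [Group G] {p : {ij : Fin n × Fin n // ij.1 ≠ ij.2} → (α → G) → G}

open IsDefinable IsTerm

theorem isDefinable_isRoot (hp : ∀ a, IsTerm groupLanguage (p a)) {x : (α → G) → G}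
    (hx : IsTerm groupLanguage x) :
    IsDefinable groupLanguage (fun v => IsRoot hn (fun a => p a v) (x v)) := by
  refine exists_elem (.and (all fun a => (const _).imp ((const _).imp (.eq ?_ ?_))) (.eq ?_ ?_))
  · exact (var _).group_mul (hp a).weaken
  · exact (hp a).weaken.group_mul (var _)
  · exact (var _).group_mul (hp _).weaken
  · exact hx.weaken.group_mul ((hp _).weaken.group_mul (var _))

theorem isDefinable_isFieldMul (hp : ∀ a, IsTerm groupLanguage (p a)) {x y z : (α → G) → G}
    (hx : IsTerm groupLanguage x) (hy : IsTerm groupLanguage y) (hz : IsTerm groupLanguage z) :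
    IsDefinable groupLanguage (fun v => IsFieldMul hn (fun a => p a v) (x v) (y v) (z v)) := by
  refine exists_elem (exists_elem (exists_elem (exists_elem
    (.and (.eq ?_ ?_) (.and (.eq ?_ ?_) (.and (.eq ?_ ?_) (.and (.eq ?_ ?_) (.eq ?_ ?_))))))))
  · exact (var _).group_mul (hp _).weaken.weaken.weaken.weaken
  · exact (hp _).weaken.weaken.weaken.weaken.group_mul (var _)
  · exact (var _).group_mul (hp _).weaken.weaken.weaken.weaken
  · exact (hp _).weaken.weaken.weaken.weaken.group_mul (var _)
  · exact (var _).group_mul hx.weaken.weaken.weaken.weaken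
  · exact (var _).group_mul (var _)
  · exact (var _).group_mul hy.weaken.weaken.weaken.weaken
  · exact (var _).group_mul (var _)
  · exact (var _).group_mul (var _)
  · exact hz.weaken.weaken.weaken.weaken.group_mul ((var _).group_mul (var _))

theorem isDefinable_isRootLink (hp : ∀ a, IsTerm groupLanguage (p a)) {x y : (α → G) → G}
    (hx : IsTerm groupLanguage x) (hy : IsTerm groupLanguage y)
    (a : {ij : Fin n × Fin n // ij.1 ≠ ij.2}) :
    IsDefinable groupLanguage (fun v => IsRootLink hn (fun a => p a v) a (x v) (y v)) := by
  refine exists_elem (.and (.eq ?_ ?_) (.and (.eq ?_ ?_) ?_))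
  · exact (var _).group_mul (hp _).weaken
  · exact (hp _).weaken.group_mul (var _)
  · exact (var _).group_mul hx.weaken
  · exact hy.weaken.group_mul (var _)
  · exact isDefinable_isRoot hn (fun a => (hp a).weaken) hy.weaken

theorem isDefinable_isEntryMatrix (k : ℕ) {α : Type}
    {p : {ij : Fin n × Fin n // ij.1 ≠ ij.2} → (α → G) → G}
    (hp : ∀ a, IsTerm groupLanguage (p a))
    {u : Fin n × Fin n → (α → G) → G} {x : (α → G) → G}
    (hu : ∀ rc, IsTerm groupLanguage (u rc)) (hx : IsTerm groupLanguage x) :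
    IsDefinable groupLanguage
      (fun v => IsEntryMatrix hn k (fun a => p a v) (fun rc => u rc v) (x v)) := by
  induction k generalizing α with
  | zero =>
    exact (eq hx group_one).and (all fun rc => eq (hu rc) (IsTerm.ite_const _ (hp _) group_one))
  | succ k ih =>
    refine any fun a => exists_tuple (exists_tuple (exists_elem (exists_elem (exists_elem
      (.and ?_ (.and ?_ (.and (.eq ?_ ?_) (.and (all fun r => ?_) (all fun rc => .eq ?_ ?_)))))))))
    · exact ih (fun a => (hp a).weaken.weaken.weaken.weaken.weaken) (fun rc => var _) (var _)
    · exact isDefinable_isRootLink hn (fun a => (hp a).weaken.weaken.weaken.weaken.weaken)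
        (var _) (var _) a
    · exact hx.weaken.weaken.weaken.weaken.weaken
    · exact (var _).group_mul (var _)
    · exact isDefinable_isFieldMul hn (fun a => (hp a).weaken.weaken.weaken.weaken.weaken)
        (var _) (var _) (var _)
    · exact (hu rc).weaken.weaken.weaken.weaken.weaken
    · exact (var _).group_mul (IsTerm.ite_const _ (var _) group_one)

theorem isDefinable_isTransvectionTuple (q : ℕ) (hp : ∀ a, IsTerm groupLanguage (p a)) :
    IsDefinable groupLanguage (fun v => IsTransvectionTuple (fun a => p a v) q) := by
  have hconj : ∀ (a) (k : ℕ),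
      IsDefinable groupLanguage (fun v => ∃ g, g * p a v = p a v ^ k * g) := fun a k =>
    exists_elem (.eq ((var _).group_mul (hp a).weaken)
      (((hp a).weaken.group_pow k).group_mul (var _)))
  refine .and (all fun a => all fun b => (const _).imp ((const _).imp (.eq ?_ ?_)))
    (.and (all fun a => all fun b => all fun c => (const _).imp ((const _).imp ((const _).imp
      (.eq ?_ ?_)))) (all fun a => .and (.not (.eq (hp a) group_one))
        (.and (.eq ((hp a).group_pow q) group_one) ((const _).imp ((hconj a 2).and (hconj a _))))))
  · exact (hp a).group_mul (hp b)
  · exact (hp b).group_mul (hp a)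
  · exact (hp a).group_mul (hp b)
  · exact (hp c).group_mul ((hp b).group_mul (hp a))

end Definable

/-! ### The predicates with the standard transvections as parameters -/

section Standard

variable {F : Type*} [Field F]

theorem rootElement_injective :
    Function.Injective (rootElement hn : F → Matrix.SpecialLinearGroup (Fin n) F) :=
  transvection_injective (cornerIndex hn).2

theorem rootElement_add (a b : F) :
    rootElement hn (a + b) = rootElement hn a * rootElement hn b :=
  transvection_add _ a b

theorem rootElement_zero : rootElement hn (0 : F) = 1 :=
  transvection_coeff_zero _

theorem isRoot_transvectionTuple_iff (x : Matrix.SpecialLinearGroup (Fin n) F) :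
    IsRoot hn (transvectionTuple n F) x ↔ ∃ a, x = rootElement hn a := by
  refine Iff.trans ?_
    (exists_commutator_iff (rowIndex hn).2 (colIndex hn).2 (cornerIndex hn).2 x)
  exact exists_congr fun y => and_congr_left fun _ =>
    ⟨fun h r c hrc h1 h2 => h ⟨(r, c), hrc⟩ h1 h2, fun h a h1 h2 => h _ _ a.2 h1 h2⟩

theorem exists_conj_of_ne (hn : 3 ≤ n) {i j k l : Fin n} (hij : i ≠ j) (hkl : k ≠ l)
    {a b : F} (ha : a ≠ 0) (hb : b ≠ 0) : ∃ g : Matrix.SpecialLinearGroup (Fin n) F,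
      g * transvection hij a = transvection hkl b * g := by
  obtain ⟨t, h1, h2⟩ := Fin.exists_ne_and_ne_of_two_lt i j hn
  exact exists_conj_transvection hij hkl h1 h2 ha hb

theorem isFieldMul_transvectionTuple_iff (a b : F) (z : Matrix.SpecialLinearGroup (Fin n) F) :
    IsFieldMul hn (transvectionTuple n F) (rootElement hn a) (rootElement hn b) z ↔
      z = rootElement hn (a * b) := by
  have key : ∀ z : Matrix.SpecialLinearGroup (Fin n) F,
      transvection (rowIndex hn).2 a * transvection (colIndex hn).2 b =
        z * (transvection (colIndex hn).2 b * transvection (rowIndex hn).2 a) ↔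
      z = rootElement hn (a * b) := by
    intro z
    have hrel := transvection_rel (rowIndex hn).2 (colIndex hn).2 (cornerIndex hn).2 a b
    exact ⟨fun h => mul_right_cancel (h.symm.trans hrel), fun h => by rw [h]; exact hrel⟩
  constructor
  · rintro ⟨g, h, x', y', hg, hh, hx, hy, hz⟩
    have hx' : x' = transvection (rowIndex hn).2 a :=
      mul_right_cancel (hx.symm.trans (mul_transvection_of_conj hg a))
    have hy' : y' = transvection (colIndex hn).2 b :=
      mul_right_cancel (hy.symm.trans (mul_transvection_of_conj hh b))
    subst hx' hy'
    exact (key z).1 hz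
  · intro hz
    obtain ⟨g, hg⟩ := exists_conj_of_ne hn (F := F) (cornerIndex hn).2 (rowIndex hn).2 one_ne_zero
      one_ne_zero
    obtain ⟨h, hh⟩ := exists_conj_of_ne hn (F := F) (cornerIndex hn).2 (colIndex hn).2 one_ne_zero
      one_ne_zero
    exact ⟨g, h, _, _, hg, hh, mul_transvection_of_conj hg a, mul_transvection_of_conj hh b,
      (key z).2 hz⟩

theorem isRootLink_transvectionTuple_iff (a : {ij : Fin n × Fin n // ij.1 ≠ ij.2})
    (x y : Matrix.SpecialLinearGroup (Fin n) F) :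
    IsRootLink hn (transvectionTuple n F) a x y ↔
      ∃ c : F, x = transvection a.2 c ∧ y = rootElement hn c := by
  simp only [IsRootLink, isRoot_transvectionTuple_iff]
  constructor
  · rintro ⟨g, hg, hx, c, rfl⟩
    exact ⟨c, mul_left_cancel (hx.trans (mul_transvection_of_conj hg c).symm), rfl⟩
  · rintro ⟨c, rfl, rfl⟩
    obtain ⟨g, hg⟩ := exists_conj_of_ne hn (F := F) a.2 (cornerIndex hn).2 one_ne_zero one_ne_zero
    exact ⟨g, hg, mul_transvection_of_conj hg c, c, rfl⟩

theorem isEntryMatrix_transvectionTuple_iff (k : ℕ)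
    (u : Fin n × Fin n → Matrix.SpecialLinearGroup (Fin n) F)
    (x : Matrix.SpecialLinearGroup (Fin n) F) :
    IsEntryMatrix hn k (transvectionTuple n F) u x ↔
      x ∈ transvections n F ^ k ∧ ∀ rc, u rc = rootElement hn (x.1 rc.1 rc.2) := by
  induction k generalizing u x with
  | zero =>
    simp only [IsEntryMatrix, pow_zero, Set.mem_one]
    refine and_congr_right fun hx => forall_congr' fun rc => ?_
    subst hx
    rw [coe_one, Matrix.one_apply]
    split_ifs
    · rfl
    · rw [rootElement_zero]
  | succ k ih =>
    have hcol : ∀ (x' : Matrix.SpecialLinearGroup (Fin n) F) {i j : Fin n} (hij : i ≠ j) (c : F)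
        (rc : Fin n × Fin n), rootElement hn ((x' * transvection hij c).1 rc.1 rc.2) =
          rootElement hn (x'.1 rc.1 rc.2) *
            if rc.2 = j then rootElement hn (c * x'.1 rc.1 i) else 1 := by
      intro x' i j hij c rc
      rw [mul_transvection_apply, rootElement_add]
      split_ifs
      · rfl
      · rw [rootElement_zero]
    simp only [IsEntryMatrix, ih, isRootLink_transvectionTuple_iff, pow_succ, Set.mem_mul]
    constructor
    · rintro ⟨a, u', w, x', y, b, ⟨hx', hu'⟩, ⟨c, rfl, rfl⟩, rfl, hw, hu⟩
      refine ⟨⟨x', hx', _, ⟨_, _, a.2, c, rfl⟩, rfl⟩, fun rc => ?_⟩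
      have hw' : ∀ r, w r = rootElement hn (c * x'.1 r a.1.1) := fun r => by
        have := hw r
        rwa [hu', isFieldMul_transvectionTuple_iff] at this
      rw [hu, hu', hw', hcol]
    · rintro ⟨⟨x', hx', _, ⟨i, j, hij, c, rfl⟩, rfl⟩, hu⟩
      refine ⟨⟨(i, j), hij⟩, fun rc => rootElement hn (x'.1 rc.1 rc.2),
        fun r => rootElement hn (c * x'.1 r i), x', _, _, ⟨hx', fun _ => rfl⟩, ⟨c, rfl, rfl⟩, rfl,
        fun r => (isFieldMul_transvectionTuple_iff hn _ _ _).2 rfl, fun rc => ?_⟩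
      rw [hu, hcol]

theorem transvection_one_pow {i j : Fin n} (hij : i ≠ j) (k : ℕ) :
    (transvection hij (1 : F)) ^ k = transvection hij (k : F) := by
  induction k with
  | zero => rw [pow_zero, Nat.cast_zero, transvection_coeff_zero]
  | succ k ih => rw [pow_succ, ih, ← transvection_add, Nat.cast_succ]

theorem isTransvectionTuple_transvectionTuple (hn : 3 ≤ n) :
    IsTransvectionTuple (transvectionTuple n F) (ringChar F) := by
  refine ⟨fun a b h1 h2 => transvection_comm a.2 b.2 h1 h2 1 1, ?_, fun a => ⟨?_, ?_, ?_⟩⟩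
  · rintro ⟨⟨i, j⟩, hij⟩ ⟨⟨j', k⟩, hjk⟩ ⟨⟨i', k'⟩, hik⟩ h1 h2 h3
    dsimp only at h1 h2 h3
    subst h1 h2 h3
    have := transvection_rel hij hjk hik (1 : F) 1
    rwa [mul_one] at this
  · intro h
    exact one_ne_zero (transvection_injective a.2 (h.trans (transvection_coeff_zero a.2).symm))
  · change (transvection a.2 (1 : F)) ^ _ = 1
    rw [transvection_one_pow, ringChar.Nat.cast_ringChar, transvection_coeff_zero]
  · intro h0
    have : CharZero F := (CharP.ringChar_zero_iff_CharZero F).1 h0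
    have hconj : ∀ k : ℕ, k ≠ 0 → ∃ g : Matrix.SpecialLinearGroup (Fin n) F,
        g * transvectionTuple n F a = transvectionTuple n F a ^ k * g := fun k hk => by
      change ∃ g, g * transvection a.2 (1 : F) = (transvection a.2 (1 : F)) ^ k * g
      rw [transvection_one_pow]
      exact exists_conj_of_ne hn a.2 a.2 one_ne_zero (Nat.cast_ne_zero.2 hk)
    exact ⟨hconj 2 two_ne_zero, hconj _ (Nat.factorial_ne_zero _)⟩

/-- The tuples which satisfy the defining relations of `IsTransvectionTuple` are the images of the
tuple of the elementary transvections under automorphisms, and these automorphisms are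
linear on `T_{1n}`. -/
theorem IsTransvectionTuple.exists_mulEquiv
    {p : {ij : Fin n × Fin n // ij.1 ≠ ij.2} → Matrix.SpecialLinearGroup (Fin n) F}
    (hp : IsTransvectionTuple p (ringChar F)) :
    ∃ σ : Matrix.SpecialLinearGroup (Fin n) F ≃* Matrix.SpecialLinearGroup (Fin n) F,
      (∀ a, p a = σ (transvectionTuple n F a)) ∧
      ∀ c, (σ (rootElement hn c)).1 = 1 + c • ((σ (rootElement hn 1)).1 - 1) := by
  obtain ⟨hcomm, hrel, hrest⟩ := hp
  let P : Fin n → Fin n → Matrix.SpecialLinearGroup (Fin n) F := fun i j =>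
    if h : i ≠ j then p ⟨(i, j), h⟩ else 1
  have hP : ∀ i j (h : i ≠ j), P i j = p ⟨(i, j), h⟩ := fun i j h => dif_pos h
  have hS : IsSteinberg P := by
    refine ⟨fun i j k l h1 h2 h3 h4 => ?_, fun i j k h1 h2 h3 => ?_⟩
    · rw [hP i j h1, hP k l h2]
      exact hcomm _ _ h3 h4
    · rw [hP i j h1, hP j k h2, hP i k h3]
      exact hrel _ _ _ rfl rfl rfl
  obtain ⟨σ, hσ⟩ := hS.exists_mulEquiv hn (fun i j h => by rw [hP i j h]; exact (hrest _).1)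
    (fun i j h => by
      rw [hP i j h]
      obtain ⟨-, hq, hc⟩ := hrest ⟨(i, j), h⟩
      by_cases h0 : ringChar F = 0
      · obtain ⟨⟨g, hg⟩, k, hk⟩ := hc h0
        exact Matrix.isNilpotent_sub_one_of_conj (by simp)
          ((Group.isUnit (p ⟨(i, j), h⟩)).map (Matrix.SpecialLinearGroup.coeMonoidHom))
          (g := (toGL g : Matrix.GeneralLinearGroup (Fin n) F))
          (h := (toGL k : Matrix.GeneralLinearGroup (Fin n) F))
          (congrArg Subtype.val hg) (congrArg Subtype.val hk)
      · exact Matrix.isNilpotent_sub_one_of_pow_ringChar h0 (congrArg Subtype.val hq))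
  have h1 : ∀ a, p a = σ (transvectionTuple n F a) := by
    rintro ⟨⟨i, j⟩, h⟩
    apply Subtype.ext
    rw [← hP i j h]
    refine Eq.trans ?_ (hσ i j h 1).symm
    rw [one_smul, add_sub_cancel]
  refine ⟨σ, h1, fun c => ?_⟩
  refine (hσ _ _ (cornerIndex hn).2 c).trans ?_
  rw [hP _ _ (cornerIndex hn).2]
  exact congrArg (fun y : Matrix.SpecialLinearGroup (Fin n) F => 1 + c • (y.1 - 1))
    (h1 (cornerIndex hn))

end Standard

end GroupPredicates

/-! ### The codes and the bi-interpretation -/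

/-- Definable predicates are assembled to an interpretation code in which every element is
represented by a single tuple. -/
theorem InterpretationCode.exists_of_isDefinable {L K : Language} {P ι : Type} [Finite ι]
    [hL : ∀ k, IsEmpty (L.Relations k)] {B : Type*} [K.Structure B]
    (D : (P → B) → (ι → B) → Prop)
    (R : ∀ {k : ℕ}, L.Functions k → (P → B) → (Fin k → ι → B) → (ι → B) → Prop)
    (hD : IsDefinable K (fun v : P ⊕ ι → B => D (fun i => v (.inl i)) (fun j => v (.inr j))))
    (hR : ∀ {k : ℕ} (f : L.Functions k),
      IsDefinable K (fun v : P ⊕ ((Fin k × ι) ⊕ ι) → B =>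
        R f (fun i => v (.inl i)) (fun m j => v (.inr (.inl (m, j))))
          (fun j => v (.inr (.inr j))))) :
    ∃ Γ : InterpretationCode L K P ι,
      (∀ p x, Γ.dom.Realize (Sum.elim p x) ↔ D p x) ∧
      ∀ (A : Type _) [L.Structure A] (p : P → B) (μ : Γ.Domain p → A),
        Function.Bijective μ →
        (∀ {k : ℕ} (f : L.Functions k) (x : Fin k → Γ.Domain p) (y : Γ.Domain p),
          R f p (fun j => (x j).1) y.1 ↔
            Language.Structure.funMap f (fun j => μ (x j)) = μ y) →
        Γ.IsCoordinateMap p μ := by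
  obtain ⟨dom, hdom⟩ := hD
  have hE : IsDefinable K (fun v : P ⊕ (ι ⊕ ι) → B => ∀ j, v (.inr (.inl j)) = v (.inr (.inr j))) :=
    .all fun j => .eq (.var _) (.var _)
  obtain ⟨eq, heq⟩ := hE
  choose fn hfn using fun k => hR (k := k)
  refine ⟨⟨dom, eq, fun {k} f => fn k f, fun {k} r => ((hL k).false r).elim⟩,
    fun p x => hdom _, fun A _ p μ hμ hf => ?_⟩
  refine ⟨hμ.2, fun x y => ?_, fun {k} f x y => ?_, fun {k} r => ((hL k).false r).elim⟩
  · rw [hμ.1.eq_iff, heq, Subtype.ext_iff, funext_iff]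
    rfl
  · rw [← hf, hfn]
    rfl

section Codes

variable {n : ℕ} (hn : 3 ≤ n) (F : Type*) [Field F]

/-- The graph of a field operation on the root subgroup `T_{1n}`. -/
def rootFieldGraph {G : Type*} [Group G] (p : {ij : Fin n × Fin n // ij.1 ≠ ij.2} → G) :
    ∀ {k : ℕ}, ringFunc k → (Fin k → G) → G → Prop
  | _, .add, x, y => y = x 0 * x 1
  | _, .mul, x, y => IsFieldMul hn p (x 0) (x 1) y
  | _, .neg, x, y => y * x 0 = 1
  | _, .zero, _, y => y = 1
  | _, .one, _, y => y = p (cornerIndex hn)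

theorem rootFieldGraph_transvectionTuple_iff {k : ℕ} (f : Language.ring.Functions k)
    (x : Fin k → F) (y : F) :
    rootFieldGraph hn (transvectionTuple n F) f (fun j => rootElement hn (x j)) (rootElement hn y) ↔
      Language.Structure.funMap f x = y := by
  cases f with
  | add =>
    change rootElement hn y = rootElement hn (x 0) * rootElement hn (x 1) ↔ x 0 + x 1 = y
    rw [← rootElement_add, (rootElement_injective hn).eq_iff, eq_comm]
  | mul =>
    change IsFieldMul hn _ _ _ _ ↔ x 0 * x 1 = y
    rw [isFieldMul_transvectionTuple_iff, (rootElement_injective hn).eq_iff, eq_comm]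
  | neg =>
    change rootElement hn y * rootElement hn (x 0) = 1 ↔ - x 0 = y
    rw [← rootElement_add, ← rootElement_zero hn, (rootElement_injective hn).eq_iff,
      neg_eq_iff_add_eq_zero, add_comm]
  | zero =>
    change rootElement hn y = 1 ↔ 0 = y
    rw [← rootElement_zero hn, (rootElement_injective hn).eq_iff, eq_comm]
  | one =>
    change rootElement hn y = rootElement hn 1 ↔ 1 = y
    rw [(rootElement_injective hn).eq_iff, eq_comm]

/-- The interpretation of `F` in `SL_n(F)` on the root subgroup `T_{1n}`. -/
theorem exists_fieldCode :
    ∃ Γ : InterpretationCode Language.ring groupLanguage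
        {ij : Fin n × Fin n // ij.1 ≠ ij.2} Unit,
      ∃ μ : Γ.Domain (transvectionTuple n F) → F,
        Γ.IsCoordinateMap (transvectionTuple n F) μ ∧ (∀ x, x.1 () = rootElement hn (μ x)) ∧
        ∀ c, ∃ x, μ x = c := by
  have : ∀ k, IsEmpty (Language.ring.Relations k) := fun k => inferInstanceAs (IsEmpty Empty)
  obtain ⟨Γ, hdom, hΓ⟩ := InterpretationCode.exists_of_isDefinable
    (L := Language.ring) (K := groupLanguage) (P := {ij : Fin n × Fin n // ij.1 ≠ ij.2})
    (ι := Unit) (B := Matrix.SpecialLinearGroup (Fin n) F)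
    (fun p x => IsRoot hn p (x ()))
    (fun f p x y => rootFieldGraph hn p f (fun j => x j ()) (y ()))
    (isDefinable_isRoot hn (fun a => .var _) (.var _))
    (fun f => by
      cases f with
      | add => exact .eq (.var _) ((IsTerm.var _).group_mul (.var _))
      | mul => exact isDefinable_isFieldMul hn (fun a => .var _) (.var _) (.var _) (.var _)
      | neg => exact .eq ((IsTerm.var _).group_mul (.var _)) .group_one
      | zero => exact .eq (.var _) .group_one
      | one => exact .eq (.var _) (.var _))
  have hroot : ∀ x : Γ.Domain (transvectionTuple n F), ∃ c : F, x.1 () = rootElement hn c :=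
    fun x => (isRoot_transvectionTuple_iff hn _).1 ((hdom _ _).1 x.2)
  choose μ hμ using hroot
  have hsurj : ∀ c, ∃ x, μ x = c := fun c =>
    ⟨⟨fun _ => rootElement hn c, (hdom _ _).2 ((isRoot_transvectionTuple_iff hn _).2 ⟨c, rfl⟩)⟩,
      rootElement_injective hn (hμ _).symm⟩
  refine ⟨Γ, μ, hΓ F _ μ ⟨fun x y hxy => Subtype.ext (funext fun _ => ?_), hsurj⟩
    (fun f x y => ?_), hμ, hsurj⟩
  · rw [hμ, hμ, hxy]
  · simp only [hμ]
    exact rootFieldGraph_transvectionTuple_iff hn F f _ _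

/-- The graph of a group operation on matrices. -/
def matrixGroupGraph {F : Type*} [Field F] : ∀ {k : ℕ}, GroupFunc k →
    (Fin k → Matrix (Fin n) (Fin n) F) → Matrix (Fin n) (Fin n) F → Prop
  | _, .mul, x, y => ∀ i j, y i j = ∑ l, x 0 i l * x 1 l j
  | _, .inv, x, y => ∀ i j, ∑ l, x 0 i l * y l j = if i = j then 1 else 0
  | _, .one, _, y => ∀ i j, y i j = if i = j then 1 else 0

theorem matrixGroupGraph_iff {k : ℕ} (f : groupLanguage.Functions k)
    (x : Fin k → Matrix.SpecialLinearGroup (Fin n) F) (y : Matrix.SpecialLinearGroup (Fin n) F) :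
    matrixGroupGraph f (fun j => (x j).1) y.1 ↔ Language.Structure.funMap f x = y := by
  have hext : ∀ A B : Matrix.SpecialLinearGroup (Fin n) F, A.1 = B.1 ↔ A = B :=
    fun A B => Subtype.ext_iff.symm
  cases f with
  | mul =>
    change (∀ i j, y.1 i j = ((x 0).1 * (x 1).1) i j) ↔ x 0 * x 1 = y
    rw [Matrix.ext_iff, ← coe_mul, hext, eq_comm]
  | inv =>
    change (∀ i j, ((x 0).1 * y.1) i j = if i = j then 1 else 0) ↔ (x 0)⁻¹ = y
    simp only [← Matrix.one_apply]
    rw [Matrix.ext_iff, ← coe_mul, ← coe_one, hext, inv_eq_iff_mul_eq_one]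
  | one =>
    change (∀ i j, y.1 i j = if i = j then 1 else 0) ↔ 1 = y
    simp only [← Matrix.one_apply]
    rw [Matrix.ext_iff, ← coe_one, hext, eq_comm]

/-- The standard interpretation of `SL_n(F)` in `F`. -/
theorem exists_groupCode (n : ℕ) :
    ∃ Δ : InterpretationCode groupLanguage Language.ring Empty (Fin n × Fin n),
      ∃ ν : Δ.Domain (Empty.elim : Empty → F) → Matrix.SpecialLinearGroup (Fin n) F,
        Δ.IsCoordinateMap Empty.elim ν ∧ (∀ x i j, (ν x).1 i j = x.1 (i, j)) ∧
        ∀ g, ∃ x, ν x = g := by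
  have : ∀ k, IsEmpty (groupLanguage.Relations k) := fun k => inferInstanceAs (IsEmpty Empty)
  obtain ⟨Δ, hdom, hΔ⟩ := InterpretationCode.exists_of_isDefinable
    (L := groupLanguage) (K := Language.ring) (P := Empty) (ι := Fin n × Fin n) (B := F)
    (fun _ x => (Matrix.of fun i j => x (i, j)).det = 1)
    (fun f _ x y => matrixGroupGraph f (fun m => Matrix.of fun i j => x m (i, j))
      (Matrix.of fun i j => y (i, j)))
    (.eq (.ring_det fun i j => .var _) .ring_one)
    (fun f => by
      cases f with
      | mul =>
        exact .all fun i => .all fun j =>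
          .eq (.var _) (.ring_sum _ fun l => (IsTerm.var _).ring_mul (.var _))
      | inv =>
        exact .all fun i => .all fun j =>
          .eq (.ring_sum _ fun l => (IsTerm.var _).ring_mul (.var _))
            (IsTerm.ite_const _ .ring_one .ring_zero)
      | one =>
        exact .all fun i => .all fun j => .eq (.var _) (IsTerm.ite_const _ .ring_one .ring_zero))
  let ν : Δ.Domain (Empty.elim : Empty → F) → Matrix.SpecialLinearGroup (Fin n) F :=
    fun x => ⟨Matrix.of fun i j => x.1 (i, j), (hdom _ _).1 x.2⟩
  have hsurj : ∀ g, ∃ x, ν x = g := fun g =>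
    ⟨⟨fun ij => g.1 ij.1 ij.2, (hdom _ _).2 g.2⟩, rfl⟩
  refine ⟨Δ, ν, hΔ _ _ ν ⟨fun x y hxy => Subtype.ext (funext fun ij => ?_), hsurj⟩
    (fun f x y => matrixGroupGraph_iff F f (fun j => ν (x j)) (ν y)), fun _ _ _ => rfl, hsurj⟩
  exact congrFun (congrFun (congrArg Subtype.val hxy) ij.1) ij.2

end Codes

theorem theoremA1 (F : Type*) [Field F] (n : ℕ) (hn : 3 ≤ n) :
    RegularlyBiInterpretable groupLanguage Language.ring
      (Matrix.SpecialLinearGroup (Fin n) F) F ∧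
    ∃ I : RegularBiInterpretation Language.ring groupLanguage
        F (Matrix.SpecialLinearGroup (Fin n) F)
        {ij : Fin n × Fin n // ij.1 ≠ ij.2} Unit Empty (Fin n × Fin n),
      I.φ.Realize (transvectionTuple n F) ∧
      (∃ μ : I.Γ.Domain (transvectionTuple n F) → F,
        I.Γ.IsCoordinateMap (transvectionTuple n F) μ ∧
        ∀ x, x.1 () = rootElement hn (μ x)) ∧
      (∃ ν : I.Δ.Domain (Empty.elim : Empty → F) → Matrix.SpecialLinearGroup (Fin n) F,
        I.Δ.IsCoordinateMap Empty.elim ν ∧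
        ∀ x i j, (ν x).1 i j = x.1 (i, j)) := by
  obtain ⟨Γ, μ, hμ, hμroot, hμsurj⟩ := exists_fieldCode hn F
  obtain ⟨Δ, ν, hν, hνentry, hνsurj⟩ := exists_groupCode F n
  obtain ⟨φ, hφ⟩ := isDefinable_isTransvectionTuple (G := Matrix.SpecialLinearGroup (Fin n) F)
    (ringChar F) (p := fun (a : {ij : Fin n × Fin n // ij.1 ≠ ij.2}) v => v a) (fun a => .var a)
  -- `θA` says that the matrix `u` is `1 + a (s - 1)`, where `s` is the parameter at `(1, n)`
  obtain ⟨θA, hθA⟩ : IsDefinable Language.ring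
      (fun v : Empty ⊕ (({ij : Fin n × Fin n // ij.1 ≠ ij.2} × (Fin n × Fin n)) ⊕
          ((Unit × (Fin n × Fin n)) ⊕ Unit)) → F =>
        ∀ ij : Fin n × Fin n, v (.inr (.inr (.inl ((), ij)))) = (if ij.1 = ij.2 then 1 else 0) +
          v (.inr (.inr (.inr ()))) * (v (.inr (.inl (cornerIndex hn, ij))) +
            -(if ij.1 = ij.2 then 1 else 0))) :=
    .all fun ij => .eq (.var _) ((IsTerm.ite_const _ .ring_one .ring_zero).ring_add
      ((IsTerm.var _).ring_mul ((IsTerm.var _).ring_add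
        (IsTerm.ite_const _ .ring_one .ring_zero).ring_neg)))
  -- `θB` says that `u` is the matrix of the entries of a product of `N` transvections
  obtain ⟨N, hN⟩ := exists_forall_mem_transvections_pow (n := n) (by omega) F
  obtain ⟨θB, hθB⟩ := isDefinable_isEntryMatrix hn (G := Matrix.SpecialLinearGroup (Fin n) F) N
    (α := {ij : Fin n × Fin n // ij.1 ≠ ij.2} ⊕
      ((Empty × Unit) ⊕ (((Fin n × Fin n) × Unit) ⊕ Unit)))
    (p := fun a v => v (.inl a)) (u := fun rc v => v (.inr (.inr (.inl (rc, ())))))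
    (x := fun v => v (.inr (.inr (.inr ())))) (fun _ => .var _) (fun _ => .var _) (.var _)
  let S : Set (groupLanguage.Equiv (Matrix.SpecialLinearGroup (Fin n) F)
      (Matrix.SpecialLinearGroup (Fin n) F)) :=
    {σ | ∀ c, (σ (rootElement hn c)).1 = 1 + c • ((σ (rootElement hn 1)).1 - 1)}
  let I := RegularBiInterpretation.ofOrbit Γ φ Δ θA θB (transvectionTuple n F)
    ((hφ _).2 (isTransvectionTuple_transvectionTuple hn)) S
    (fun p hp => by
      obtain ⟨σ, hσ, hlin⟩ := IsTransvectionTuple.exists_mulEquiv hn ((hφ p).1 hp)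
      exact ⟨σ.groupLanguageEquiv, hlin, hσ⟩)
    μ hμ Empty.elim ν hν
    (fun σ hσ s hs u a => by
      have hcorner : ν (s (cornerIndex hn)) = σ (rootElement hn 1) := hs (cornerIndex hn)
      have h1 : (∃ x : Γ.Domain (transvectionTuple n F), (∀ j, ν (u j) = σ (x.1 j)) ∧ μ x = a) ↔
          ν (u ()) = σ (rootElement hn a) := by
        constructor
        · rintro ⟨x, hx, rfl⟩
          rw [hx, hμroot]
        · intro h
          obtain ⟨x, rfl⟩ := hμsurj a
          exact ⟨x, fun j => by rw [hμroot]; exact h, rfl⟩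
      have h2 : ν (u ()) = σ (rootElement hn a) ↔
          (ν (u ())).1 = 1 + a • ((ν (s (cornerIndex hn))).1 - 1) := by
        rw [hcorner, ← hσ a]
        exact Subtype.ext_iff
      rw [h1, h2, ← Matrix.ext_iff]
      refine (hθA _).trans ?_
      simp only [Sum.elim_inr, Sum.elim_inl, Prod.forall, Matrix.add_apply, Matrix.smul_apply,
        Matrix.neg_apply, Matrix.one_apply, hνentry, smul_eq_mul, sub_eq_add_neg])
    (fun s u b => by
      refine (hθB _).trans ((isEntryMatrix_transvectionTuple_iff hn N _ b).trans ?_)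
      simp only [hN b, true_and, Sum.elim_inr, Sum.elim_inl, hμroot,
        (rootElement_injective hn).eq_iff]
      constructor
      · intro h
        obtain ⟨x, rfl⟩ := hνsurj b
        exact ⟨x, fun k => by rw [h, hνentry], rfl⟩
      · rintro ⟨x, hx, rfl⟩ k
        rw [hνentry, hx])
  exact ⟨⟨_, _, _, _, inferInstance, inferInstance, inferInstance, inferInstance, ⟨I.symm⟩⟩,
    I, (hφ _).2 (isTransvectionTuple_transvectionTuple hn), ⟨μ, hμ, hμroot⟩, ⟨ν, hν, hνentry⟩⟩
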